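/- Let $\Bbbk$ be an algebraically closed field of characteristic zero. For a non-empty finite subset $A=\{u_0,\dots,u_m\}$ (with $u_0,\dots,u_m$ distinct) of a free abelian group $M$ of finite rank, let $X_A\subset\mathbb{P}^m$ be the Zariski closure of the image of $$\varphi_A: T_M=\operatorname{Spec}\Bbbk[M]\to\mathbb{P}^m,\qquad t\mapsto[z^{u_0}(t):\dots:z^{u_m}(t)],$$ on which the torus acts by $t\cdot[x_0:\dots:x_m]=[z^{u_0}(t)x_0:\dots:z^{u_m}(t)x_m]$. Let $X\subset\mathbb{P}^N$ be a projectively embedded toric variety, i.e. $X$ is projectively equivalent to such an $X_A$: there are linear embeddings $\jmath_1:\mathbb{P}^N\hookrightarrow\mathbb{P}^L$ and $\jmath_2:\mathbb{P}^m\hookrightarrow\mathbb{P}^L$ with $\jmath_1(X)=\jmath_2(X_A)$; let the torus act on $X$ through the identification $X\cong X_A$ given by $\jmath_1,\jmath_2$. Let $n=\dim X$, and let $\gamma:X\dashrightarrow\mathbb{G}(n,\mathbb{P}^N)$ be the Gauss map, which sends a smooth point $x\in X$ to the embedded tangent space $\mathbb{T}_xX\subset\mathbb{P}^N$. Let the Gauss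 defect $\delta=\delta_\gamma(X)$ be the dimension of a general fiber of $\gamma$; that is, for all $x$ in some non-empty open subset of the smooth locus of $X$, the fiber of $\gamma$ through $x$ has dimension $\delta$. Then $\delta$ is well defined, and there exist pairwise disjoint, torus-invariant closed (irreducible, non-empty) subvarieties $X_0,\dots,X_\delta\subset X$ such that $X$ is the join of $X_0,\dots,X_\delta$, i.e. $X$ is the closure in $\mathbb{P}^N$ of the union of the linear spans $\langle x_0,\dots,x_\delta\rangle$ over all $x_0\in X_0,\dots,x_\delta\in X_\delta$. -/

import Mathlib

open scoped LinearAlgebra.Projectivization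

noncomputable section

namespace ToricGauss

section ProjectiveSpace

variable {k : Type*} [Field k] {ι : Type*}

/-- The common zeros in projective space of a set of polynomials; it is used for sets of
homogeneous polynomials only, where the choice of representatives is irrelevant. -/
def zeroLocus (S : Set (MvPolynomial ι k)) : Set (ℙ k (ι → k)) :=
  {p | ∀ f ∈ S, MvPolynomial.eval p.rep f = 0}

/-- The Zariski topology on projective space: the closed sets are the zero loci of sets of
homogeneous polynomials. -/
instance zariskiTopology : TopologicalSpace (ℙ k (ι → k)) :=
  TopologicalSpace.ofClosed
    {Z | ∃ S : Set (MvPolynomial ι k),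
      (∀ f ∈ S, ∃ d : ℕ, f.IsHomogeneous d) ∧ Z = zeroLocus S}
    ⟨{1}, by
      rintro f rfl
      exact ⟨0, MvPolynomial.isHomogeneous_one ι k⟩, by
      ext p
      simp [zeroLocus]⟩
    (by
      intro 𝒵 h𝒵
      have h : ∀ Z ∈ 𝒵, ∃ S : Set (MvPolynomial ι k),
          (∀ f ∈ S, ∃ d : ℕ, f.IsHomogeneous d) ∧ Z = zeroLocus S := fun Z hZ => h𝒵 hZ
      choose! S hS using h
      refine ⟨⋃ Z ∈ 𝒵, S Z, ?_, ?_⟩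
      · intro f hf
        simp only [Set.mem_iUnion] at hf
        obtain ⟨Z, hZ, hf⟩ := hf
        exact (hS Z hZ).1 f hf
      · ext p
        simp only [Set.mem_sInter, zeroLocus, Set.mem_ofPred_eq, Set.mem_iUnion]
        constructor
        · rintro h f ⟨Z, hZ, hf⟩
          have := h Z hZ
          rw [(hS Z hZ).2] at this
          exact this f hf
        · intro h Z hZ
          rw [(hS Z hZ).2]
          exact fun f hf => h f ⟨Z, hZ, hf⟩)
    (by
      rintro _ ⟨S, hS, rfl⟩ _ ⟨S', hS', rfl⟩
      refine ⟨{h | ∃ f ∈ S, ∃ g ∈ S', h = f * g}, ?_, ?_⟩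
      · rintro _ ⟨f, hf, g, hg, rfl⟩
        obtain ⟨a, ha⟩ := hS f hf
        obtain ⟨b, hb⟩ := hS' g hg
        exact ⟨a + b, ha.mul hb⟩
      · ext p
        simp only [Set.mem_union, zeroLocus, Set.mem_ofPred_eq]
        constructor
        · rintro (h | h) _ ⟨f, hf, g, hg, rfl⟩
          · simp [h f hf]
          · simp [h g hg]
        · intro h
          by_contra hcon
          push Not at hcon
          obtain ⟨⟨f, hf, hf0⟩, g, hg, hg0⟩ := hcon
          have := h _ ⟨f, hf, g, hg, rfl⟩
          rw [map_mul] at this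
          exact (mul_ne_zero hf0 hg0) this)

/-- A (closed) projective subvariety of projective space: closed, irreducible, non-empty. -/
def IsProjectiveVariety (X : Set (ℙ k (ι → k))) : Prop :=
  IsClosed X ∧ IsIrreducible X

/-- The embedded join: the closure of the union of the linear spans of `x₁, …, xₘ` with
`xⱼ ∈ Xⱼ`. -/
def join {m : Type*} (X : m → Set (ℙ k (ι → k))) : Set (ℙ k (ι → k)) :=
  closure {p | ∃ x : m → ℙ k (ι → k), (∀ j, x j ∈ X j) ∧
    p ∈ Projectivization.Subspace.span (Set.range x)}

/-- The embedded tangent space of `X` at `x`, as a linear subspace of `k^ι`: the common kernel of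
the differentials at `x` of the homogeneous polynomials that vanish on `X`. -/
def embeddedTangentSpace [Fintype ι] (X : Set (ℙ k (ι → k))) (x : ℙ k (ι → k)) :
    Submodule k (ι → k) where
  carrier := {w | ∀ (f : MvPolynomial ι k) (d : ℕ), f.IsHomogeneous d →
    (∀ p ∈ X, MvPolynomial.eval p.rep f = 0) →
    ∑ i, MvPolynomial.eval x.rep (MvPolynomial.pderiv i f) * w i = 0}
  add_mem' := by
    intro a b ha hb f d hf hX
    simp [mul_add, Finset.sum_add_distrib, ha f d hf hX, hb f d hf hX]
  zero_mem' := by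
    intro f d _ _
    simp
  smul_mem' := by
    intro c w hw f d hf hX
    have := hw f d hf hX
    simp only [Pi.smul_apply, smul_eq_mul, mul_left_comm _ c, ← Finset.mul_sum, this, mul_zero]

/-- The smooth points of `X`: those where the embedded tangent space, of projective dimension
`finrank - 1`, has the dimension of `X`. -/
def smoothLocus [Fintype ι] (X : Set (ℙ k (ι → k))) : Set (ℙ k (ι → k)) :=
  {x | x ∈ X ∧
    ((Module.finrank k (embeddedTangentSpace X x) : ℕ∞) : WithBot ℕ∞) = topologicalKrullDim X + 1}

/-- The fiber through `x` of the Gauss map `y ↦ 𝕋_y X`, which is defined on the smooth points. -/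
def gaussFiber [Fintype ι] (X : Set (ℙ k (ι → k))) (x : ℙ k (ι → k)) : Set (ℙ k (ι → k)) :=
  {y | y ∈ smoothLocus X ∧ embeddedTangentSpace X y = embeddedTangentSpace X x}

/-- `δ` is the Gauss defect of the variety `X`, the dimension of a general fiber of the Gauss map:
for all `x` in some non-empty open subset of `X`, the fiber through `x` has dimension `δ`. -/
def IsGaussDefect [Fintype ι] (X : Set (ℙ k (ι → k))) (δ : ℕ) : Prop :=
  ∃ U : Set (ℙ k (ι → k)), IsOpen U ∧ (X ∩ U).Nonempty ∧
    ∀ x ∈ X ∩ U, x ∈ smoothLocus X ∧ topologicalKrullDim (gaussFiber X x) = ((δ : ℕ∞) : WithBot ℕ∞)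

/-- A variety has at most one Gauss defect. -/
theorem IsGaussDefect.unique [Fintype ι] {X : Set (ℙ k (ι → k))} (hX : IsIrreducible X)
    {a b : ℕ} (ha : IsGaussDefect X a) (hb : IsGaussDefect X b) : a = b := by
  obtain ⟨U, hU, hUX, hUa⟩ := ha
  obtain ⟨V, hV, hVX, hVb⟩ := hb
  obtain ⟨x, hx, hxU, hxV⟩ := hX.2 U V hU hV hUX hVX
  have h := (hUa x ⟨hx, hxU⟩).2.symm.trans (hVb x ⟨hx, hxV⟩).2
  exact_mod_cast h

end ProjectiveSpace

section Toric

variable (k : Type*) [Field k] {M : Type*} [AddCommGroup M]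

/-- The closed points of the algebraic torus `T_M = Spec k[M]` (`k` algebraically closed), that is,
the homomorphisms from `M` to the multiplicative group of `k`; `t (ofAdd u)` is the value of the
monomial `z^u` at `t`. -/
abbrev Torus (M : Type*) [AddCommGroup M] : Type _ := Multiplicative M →* kˣ

variable {k}

/-- The morphism `φ_A : T_M → ℙ^N`, `t ↦ [z^u(t)]_{u ∈ A}`; the homogeneous coordinates of `ℙ^N`,
`N = #A - 1`, are indexed by `A`. -/
def toricMap (A : Finset M) (hA : A.Nonempty) (t : Torus k M) : ℙ k (A → k) :=
  Projectivization.mk k (fun u : A => (t (Multiplicative.ofAdd (u : M)) : k)) (by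
    obtain ⟨u, hu⟩ := hA
    intro h
    exact (t (Multiplicative.ofAdd u)).ne_zero (congrFun h ⟨u, hu⟩))

variable (k) in
/-- The toric variety `X_A`, the closure of the image of `φ_A`. -/
def toricVariety (A : Finset M) (hA : A.Nonempty) : Set (ℙ k (A → k)) :=
  closure (Set.range (toricMap (k := k) A hA))

/-- The action of `t ∈ T_M` on `ℙ^N`, `[x_u]_u ↦ [z^u(t) x_u]_u`. It factors through the quotient
`T_M → T_{⟨A - A⟩}`, which is surjective on closed points if `k` is algebraically closed, so that
`T_M` and `T_{⟨A - A⟩}` have the same invariant subsets. -/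
def torusAction (A : Finset M) (t : Torus k M) : ℙ k (A → k) → ℙ k (A → k) :=
  Projectivization.map
    (LinearEquiv.piCongrRight fun u : A =>
      LinearEquiv.smulOfUnit (M := k) (t (Multiplicative.ofAdd (u : M)))).toLinearMap
    (LinearEquiv.injective _)

/-- A subset of `ℙ^N` that is stable under the torus. -/
def IsTorusInvariant (A : Finset M) (Y : Set (ℙ k (A → k))) : Prop :=
  ∀ t : Torus k M, ∀ y ∈ Y, torusAction A t y ∈ Y

end Toric

end ToricGauss

end

noncomputable section

namespace ToricGauss

/-!
Put the points of `A` at height one. Then `X_A` is the locus of points at which a monomial depends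
on its weight only, and its embedded tangent space at the unit point `[1 : ⋯ : 1]` is the space `W`
of linear functions of the weights. The functions `g` with `g W ⊆ W` form an algebra, hence are the
functions that are constant on the blocks of a partition of `A`, in `δ + 1` blocks say. The fiber of
the Gauss map through the unit point consists of such functions and contains all those without
zeros, so it has dimension `δ`; the torus carries it to every point of the open orbit. As the
indicator function of a block maps `W` to itself, in characteristic zero every relation between the
weights is a sum of relations within the blocks. Hence the indicators of the blocks lie on `X_A`,
the closures of their torus orbits are disjoint, and their join is `X_A`.
-/

open MvPolynomial

section ProjectiveSpace

variable {k : Type*} [Field k] {ι κ σ : Type*}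

theorem aeval_smul_of_isHomogeneous {R S : Type*} [CommSemiring R] [CommSemiring S] [Algebra R S]
    {f : MvPolynomial ι R} {d : ℕ} (hf : f.IsHomogeneous d) (c : S) (w : ι → S) :
    aeval (c • w) f = c ^ d * aeval w f := by
  simp only [aeval_def, eval₂_eq, Finset.mul_sum]
  refine Finset.sum_congr rfl fun m hm => ?_
  rw [show d = ∑ i ∈ m.support, m i from hf.degree_eq_sum_deg_support hm]
  simp only [Pi.smul_apply, smul_eq_mul, mul_pow, Finset.prod_mul_distrib,
    Finset.prod_pow_eq_pow_sum]
  ring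

theorem eval_smul_of_isHomogeneous {f : MvPolynomial ι k} {d : ℕ} (hf : f.IsHomogeneous d)
    (c : k) (v : ι → k) : eval (c • v) f = c ^ d * eval v f := by
  simpa only [aeval_eq_eval] using aeval_smul_of_isHomogeneous hf c v

theorem eval_rep_mk_eq_zero_iff {f : MvPolynomial ι k} {d : ℕ} (hf : f.IsHomogeneous d)
    (v : ι → k) (hv : v ≠ 0) :
    eval (Projectivization.mk k v hv).rep f = 0 ↔ eval v f = 0 := by
  obtain ⟨c, hc⟩ := Projectivization.exists_smul_eq_mk_rep k v hv
  rw [← hc, Units.smul_def, eval_smul_of_isHomogeneous hf]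
  simp

theorem isClosed_iff_exists_zeroLocus {Z : Set (ℙ k (ι → k))} :
    IsClosed Z ↔ ∃ S : Set (MvPolynomial ι k),
      (∀ f ∈ S, ∃ d : ℕ, f.IsHomogeneous d) ∧ Z = zeroLocus S := by
  rw [← isOpen_compl_iff]
  change Zᶜᶜ ∈ _ ↔ _
  rw [compl_compl]
  rfl

theorem isClosed_setOf_eval_rep_eq_zero {f : MvPolynomial ι k} {d : ℕ} (hf : f.IsHomogeneous d) :
    IsClosed {p : ℙ k (ι → k) | eval p.rep f = 0} :=
  isClosed_iff_exists_zeroLocus.2 ⟨{f}, by rintro _ rfl; exact ⟨d, hf⟩, by ext; simp [zeroLocus]⟩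

theorem mem_closure_iff_eval {W : Set (ℙ k (ι → k))} {p : ℙ k (ι → k)} :
    p ∈ closure W ↔ ∀ (f : MvPolynomial ι k) (d : ℕ), f.IsHomogeneous d →
      (∀ q ∈ W, eval q.rep f = 0) → eval p.rep f = 0 := by
  constructor
  · exact fun hp f d hf hW => closure_minimal hW (isClosed_setOf_eval_rep_eq_zero hf) hp
  · intro h
    obtain ⟨S, hS, hW⟩ := isClosed_iff_exists_zeroLocus.1 (isClosed_closure (s := W))
    rw [hW]
    intro f hf
    obtain ⟨d, hd⟩ := hS f hf
    exact h f d hd fun q hq => (hW ▸ subset_closure hq : q ∈ zeroLocus S) f hf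

theorem mk_mem_closure_iff {W : Set (ℙ k (ι → k))} {v : ι → k} {hv : v ≠ 0} :
    Projectivization.mk k v hv ∈ closure W ↔ ∀ (f : MvPolynomial ι k) (d : ℕ), f.IsHomogeneous d →
      (∀ q ∈ W, eval q.rep f = 0) → eval v f = 0 := by
  rw [mem_closure_iff_eval]
  refine forall₃_congr fun f d hf => ?_
  rw [eval_rep_mk_eq_zero_iff hf]

theorem exists_eval_ne_zero_of_notMem {Z : Set (ℙ k (ι → k))} (hZ : IsClosed Z)
    {p : ℙ k (ι → k)} (hp : p ∉ Z) : ∃ (f : MvPolynomial ι k) (d : ℕ), f.IsHomogeneous d ∧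
      (∀ q ∈ Z, eval q.rep f = 0) ∧ eval p.rep f ≠ 0 := by
  rw [← hZ.closure_eq, mem_closure_iff_eval] at hp
  push Not at hp
  exact hp

/-- The `k[ε]`-point `v + ε w` of affine space, with base point `v` and direction `w`: the value
of a polynomial at it has as `ε`-coefficient the derivative at `v` in the direction `w`. -/
def dualPoint (v w : ι → k) (i : ι) : DualNumber k :=
  TrivSqZeroExt.inl (v i) + TrivSqZeroExt.inr (w i)

theorem aeval_dualPoint [Fintype ι] (f : MvPolynomial ι k) (v w : ι → k) :
    aeval (dualPoint v w) f =
      TrivSqZeroExt.inl (eval v f) + TrivSqZeroExt.inr (∑ i, eval v (pderiv i f) * w i) := by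
  classical
  induction f using MvPolynomial.induction_on with
  | C a => simp [TrivSqZeroExt.algebraMap_eq_inl]
  | add p q hp hq =>
    simp only [map_add, hp, hq, add_mul, Finset.sum_add_distrib, TrivSqZeroExt.inl_add,
      TrivSqZeroExt.inr_add]
    abel
  | mul_X p i hp =>
    rw [map_mul, hp, aeval_X, dualPoint]
    ext
    · simp
    · simp only [TrivSqZeroExt.snd_mul, TrivSqZeroExt.fst_add, TrivSqZeroExt.snd_add,
        TrivSqZeroExt.fst_inl, TrivSqZeroExt.fst_inr, TrivSqZeroExt.snd_inl,
        TrivSqZeroExt.snd_inr, Derivation.leibniz, pderiv_X, map_add, smul_eq_mul, map_mul,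
        eval_X, add_mul, Finset.sum_add_distrib, MulOpposite.smul_eq_mul_unop, MulOpposite.unop_op]
      simp [Pi.single_apply, apply_ite, Finset.mul_sum, mul_comm, mul_left_comm]

theorem mem_embeddedTangentSpace_mk [Fintype ι] {X : Set (ℙ k (ι → k))} {v : ι → k} {hv : v ≠ 0}
    {w : ι → k} : w ∈ embeddedTangentSpace X (Projectivization.mk k v hv) ↔
      ∀ (f : MvPolynomial ι k) (d : ℕ), f.IsHomogeneous d → (∀ p ∈ X, eval p.rep f = 0) →
        (aeval (dualPoint v w) f).snd = 0 := by
  obtain ⟨c, hc⟩ := Projectivization.exists_smul_eq_mk_rep k v hv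
  refine forall₄_congr fun f d hf _ => ?_
  rw [← hc, Units.smul_def, aeval_dualPoint]
  simp_rw [eval_smul_of_isHomogeneous hf.pderiv, mul_assoc, ← Finset.mul_sum]
  simp

theorem linearMap_apply_eq_sum_single [Fintype ι] [DecidableEq ι] (j : (ι → k) →ₗ[k] (κ → k))
    (v : ι → k) (c : κ) : j v c = ∑ i, j (Pi.single i 1) c * v i := by
  conv_lhs => rw [pi_eq_sum_univ' v]
  simp only [map_sum, map_smul, Finset.sum_apply, Pi.smul_apply, smul_eq_mul, mul_comm]

open Classical in
/-- Precomposition of a polynomial with a linear map, for a finite index type `ι`. -/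
def linearPullback (j : (ι → k) →ₗ[k] (κ → k)) : MvPolynomial κ k →ₐ[k] MvPolynomial ι k :=
  aeval fun c => ∑ᶠ i, C (j (Pi.single i 1) c) * X i

theorem linearPullback_X [Fintype ι] [DecidableEq ι] (j : (ι → k) →ₗ[k] (κ → k)) (c : κ) :
    linearPullback j (X c) = ∑ i, C (j (Pi.single i 1) c) * X i := by
  rw [linearPullback, aeval_X, finsum_eq_sum_of_fintype]
  congr!

theorem linearPullback_zero_X (c : κ) :
    linearPullback (0 : (ι → k) →ₗ[k] (κ → k)) (X c) = 0 := by
  simp [linearPullback]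

section LinearPullback

variable [Finite ι]

theorem linearPullback_X_isHomogeneous (j : (ι → k) →ₗ[k] (κ → k)) (c : κ) :
    (linearPullback j (X c)).IsHomogeneous 1 := by
  classical
  cases nonempty_fintype ι
  rw [linearPullback_X]
  exact IsHomogeneous.sum _ _ _ fun i _ => isHomogeneous_C_mul_X _ _

theorem linearPullback_isHomogeneous (j : (ι → k) →ₗ[k] (κ → k)) {f : MvPolynomial κ k} {d : ℕ}
    (hf : f.IsHomogeneous d) : (linearPullback j f).IsHomogeneous d := by
  rw [aeval_unique (linearPullback j), ← one_mul d]
  exact hf.aeval _ (linearPullback_X_isHomogeneous j)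

theorem eval_linearPullback (j : (ι → k) →ₗ[k] (κ → k)) (f : MvPolynomial κ k) (v : ι → k) :
    eval v (linearPullback j f) = eval (j v) f := by
  classical
  cases nonempty_fintype ι
  suffices (aeval v).comp (linearPullback j) = aeval (j v) by
    simpa only [AlgHom.comp_apply, aeval_eq_eval] using DFunLike.congr_fun this f
  ext c
  simp [linearPullback_X, linearMap_apply_eq_sum_single j v c]

theorem aeval_dualPoint_linearPullback (j : (ι → k) →ₗ[k] (κ → k)) (f : MvPolynomial κ k)
    (v w : ι → k) :
    aeval (dualPoint v w) (linearPullback j f) = aeval (dualPoint (j v) (j w)) f := by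
  classical
  cases nonempty_fintype ι
  suffices (aeval (dualPoint v w)).comp (linearPullback j) = aeval (dualPoint (j v) (j w)) from
    DFunLike.congr_fun this f
  refine algHom_ext fun c => ?_
  simp only [AlgHom.comp_apply, linearPullback_X]
  ext
  · simp [dualPoint, linearMap_apply_eq_sum_single j v c, TrivSqZeroExt.fst_sum,
      TrivSqZeroExt.algebraMap_eq_inl]
  · simp [dualPoint, linearMap_apply_eq_sum_single j w c, TrivSqZeroExt.snd_sum,
      TrivSqZeroExt.algebraMap_eq_inl]

theorem linearPullback_comp [Finite κ] (l : (κ → k) →ₗ[k] (σ → k)) (j : (ι → k) →ₗ[k] (κ → k))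
    (f : MvPolynomial σ k) :
    linearPullback j (linearPullback l f) = linearPullback (l ∘ₗ j) f := by
  classical
  cases nonempty_fintype ι
  cases nonempty_fintype κ
  suffices (linearPullback j).comp (linearPullback l) = linearPullback (l ∘ₗ j) from
    DFunLike.congr_fun this f
  refine algHom_ext fun s => ?_
  simp only [AlgHom.comp_apply, linearPullback_X, map_sum, map_mul, algHom_C, algebraMap_eq,
    LinearMap.comp_apply, linearMap_apply_eq_sum_single l (j _), Finset.mul_sum, Finset.sum_mul]
  rw [Finset.sum_comm]
  simp only [mul_assoc]

theorem linearPullback_id (f : MvPolynomial ι k) : linearPullback LinearMap.id f = f := by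
  classical
  cases nonempty_fintype ι
  suffices linearPullback LinearMap.id = AlgHom.id k (MvPolynomial ι k) from
    DFunLike.congr_fun this f
  refine algHom_ext fun i => ?_
  simp [linearPullback_X, Pi.single_apply, apply_ite]

end LinearPullback

end ProjectiveSpace

section Span

variable {K V W m : Type*} [Field K] [AddCommGroup V] [Module K V] [AddCommGroup W] [Module K W]

theorem span_range_eq_projectivization (x : m → ℙ K V) :
    Projectivization.Subspace.span (Set.range x) = (⨆ i, (x i).submodule).projectivization := by
  apply le_antisymm
  · rw [Projectivization.Subspace.span_le_subspace_iff]
    rintro _ ⟨i, rfl⟩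
    rw [SetLike.mem_coe, Submodule.mem_projectivization_iff_submodule_le]
    exact le_iSup (fun i => (x i).submodule) i
  · rw [OrderIso.symm_apply_le, iSup_le_iff]
    intro i
    rw [← Submodule.mem_projectivization_iff_submodule_le, OrderIso.symm_apply_apply]
    exact Projectivization.Subspace.subset_span _ ⟨i, rfl⟩

theorem mk_mem_span_range_mk_iff {v : m → V} (hv : ∀ i, v i ≠ 0) {w : V} (hw : w ≠ 0) :
    Projectivization.mk K w hw ∈
        Projectivization.Subspace.span (Set.range fun i => Projectivization.mk K (v i) (hv i)) ↔
      w ∈ Submodule.span K (Set.range v) := by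
  simp only [span_range_eq_projectivization, Submodule.mk_mem_projectivization_iff,
    Projectivization.submodule_mk, Submodule.span_range_eq_iSup]

theorem submodule_map (j : V →ₗ[K] W) (hj : Function.Injective j) (p : ℙ K V) :
    (Projectivization.map j hj p).submodule = p.submodule.map j := by
  induction p using Projectivization.ind with
  | h v hv => rw [Projectivization.map_mk, Projectivization.submodule_mk,
      Projectivization.submodule_mk, Submodule.map_span, Set.image_singleton]

theorem mem_span_range_map_iff (j : V →ₗ[K] W) (hj : Function.Injective j) (x : m → ℙ K V)
    {q : ℙ K W} :
    q ∈ Projectivization.Subspace.span (Set.range fun i => Projectivization.map j hj (x i)) ↔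
      ∃ p ∈ Projectivization.Subspace.span (Set.range x), Projectivization.map j hj p = q := by
  simp only [span_range_eq_projectivization, submodule_map, ← Submodule.map_iSup]
  constructor
  · induction q using Projectivization.ind with
    | h w hw =>
      rintro ⟨v, hv, rfl⟩
      have hv0 : v ≠ 0 := fun h => hw (by rw [h, map_zero])
      exact ⟨.mk K v hv0, hv, Projectivization.map_mk j hj v hv0⟩
  · rintro ⟨p, hp, rfl⟩
    rw [Submodule.mem_projectivization_iff_submodule_le] at hp ⊢
    rw [submodule_map]
    exact Submodule.map_mono hp

end Span

section LinearEmbedding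

variable {k : Type*} [Field k] {ι κ : Type*}
  (j : (ι → k) →ₗ[k] (κ → k)) (hj : Function.Injective j)

section

variable [Finite ι]

theorem eval_rep_map_eq_zero_iff {f : MvPolynomial κ k} {d : ℕ} (hf : f.IsHomogeneous d)
    (p : ℙ k (ι → k)) :
    eval (Projectivization.map j hj p).rep f = 0 ↔ eval p.rep (linearPullback j f) = 0 := by
  induction p using Projectivization.ind with
  | h v hv =>
    rw [Projectivization.map_mk, eval_rep_mk_eq_zero_iff hf,
      eval_rep_mk_eq_zero_iff (linearPullback_isHomogeneous j hf), eval_linearPullback]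

theorem forall_mem_map_image_eval_eq_zero_iff {f : MvPolynomial κ k} {d : ℕ}
    (hf : f.IsHomogeneous d) (Z : Set (ℙ k (ι → k))) :
    (∀ q ∈ Projectivization.map j hj '' Z, eval q.rep f = 0) ↔
      ∀ p ∈ Z, eval p.rep (linearPullback j f) = 0 := by
  simp only [Set.forall_mem_image, eval_rep_map_eq_zero_iff j hj hf]

theorem continuous_map : Continuous (Projectivization.map j hj) := by
  refine continuous_iff_isClosed.2 fun Z hZ => closure_subset_iff_isClosed.1 fun p hp => ?_
  rw [Set.mem_preimage, ← hZ.closure_eq, mem_closure_iff_eval]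
  intro f d hf hfZ
  rw [eval_rep_map_eq_zero_iff j hj hf]
  exact mem_closure_iff_eval.1 hp _ d (linearPullback_isHomogeneous j hf) fun q hq =>
    (eval_rep_map_eq_zero_iff j hj hf q).1 (hfZ _ hq)

end

variable {j}

section

variable [Finite ι] [Finite κ]

theorem eval_linearPullback_leftInverse_eq_zero {r : (κ → k) →ₗ[k] (ι → k)}
    (hr : r ∘ₗ j = LinearMap.id) {f : MvPolynomial ι k} {d : ℕ} (hf : f.IsHomogeneous d)
    {Z : Set (ℙ k (ι → k))} (hfZ : ∀ p ∈ Z, eval p.rep f = 0) :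
    ∀ q ∈ Projectivization.map j hj '' Z, eval q.rep (linearPullback r f) = 0 := by
  rw [forall_mem_map_image_eval_eq_zero_iff j hj (linearPullback_isHomogeneous r hf),
    linearPullback_comp, hr, linearPullback_id]
  exact hfZ

theorem eval_linearPullback_X_eq_zero {l : (κ → k) →ₗ[k] (κ → k)} (hl : l ∘ₗ j = 0) (c : κ)
    (Z : Set (ℙ k (ι → k))) :
    ∀ q ∈ Projectivization.map j hj '' Z, eval q.rep (linearPullback l (X c)) = 0 := by
  rw [forall_mem_map_image_eval_eq_zero_iff j hj (linearPullback_X_isHomogeneous l c),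
    linearPullback_comp, hl, linearPullback_zero_X]
  simp

-- For a left inverse `r` of `j`, the image of `Z` is cut out by the linear equations
-- `q = j (r q)` together with the equations of `Z` evaluated at `r q`.
theorem isClosedMap_map : IsClosedMap (Projectivization.map j hj) := by
  intro Z hZ
  obtain ⟨r, hr⟩ := j.exists_leftInverse_of_injective (LinearMap.ker_eq_bot.2 hj)
  refine closure_subset_iff_isClosed.1 fun q hq => ?_
  induction q using Projectivization.ind with
  | h w hw =>
    have hl : (LinearMap.id - j ∘ₗ r) ∘ₗ j = 0 := by
      rw [LinearMap.sub_comp, LinearMap.comp_assoc, hr, LinearMap.id_comp, LinearMap.comp_id,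
        sub_self]
    have hjr : j (r w) = w := by
      ext c
      have h := mk_mem_closure_iff.1 hq _ 1 (linearPullback_X_isHomogeneous _ c)
        (eval_linearPullback_X_eq_zero hj hl c Z)
      rw [eval_linearPullback, eval_X] at h
      exact (sub_eq_zero.1 h).symm
    have hrw : r w ≠ 0 := fun h => hw (by rw [← hjr, h, map_zero])
    refine ⟨Projectivization.mk k (r w) hrw, ?_, ?_⟩
    · rw [← hZ.closure_eq, mk_mem_closure_iff]
      intro f d hf hfZ
      rw [← eval_linearPullback]
      exact mk_mem_closure_iff.1 hq _ d (linearPullback_isHomogeneous r hf)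
        (eval_linearPullback_leftInverse_eq_zero hj hr hf hfZ)
    · simp only [Projectivization.map_mk, hjr]

theorem isClosedEmbedding_map : Topology.IsClosedEmbedding (Projectivization.map j hj) :=
  .of_continuous_injective_isClosedMap (continuous_map j hj)
    (Projectivization.map_injective j hj) (isClosedMap_map hj)

theorem topologicalKrullDim_map_image (F : Set (ℙ k (ι → k))) :
    topologicalKrullDim (Projectivization.map j hj '' F) = topologicalKrullDim F :=
  ((isClosedEmbedding_map hj).isEmbedding.homeomorphImage
    F).isHomeomorph.topologicalKrullDim_eq.symm

theorem IsProjectiveVariety.map {Y : Set (ℙ k (ι → k))} (hY : IsProjectiveVariety Y) :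
    IsProjectiveVariety (Projectivization.map j hj '' Y) :=
  ⟨isClosedMap_map hj Y hY.1, hY.2.image _ (continuous_map j hj).continuousOn⟩

theorem join_map_image {m : Type*} (Y : m → Set (ℙ k (ι → k))) :
    join (fun i => Projectivization.map j hj '' Y i) = Projectivization.map j hj '' join Y := by
  rw [join, join, ← (isClosedEmbedding_map hj).closure_image_eq]
  congr 1
  apply Set.Subset.antisymm
  · rintro p ⟨x, hx, hp⟩
    choose y hy hyx using hx
    obtain rfl : (fun i => Projectivization.map j hj (y i)) = x := funext hyx
    obtain ⟨q, hq, rfl⟩ := (mem_span_range_map_iff j hj y).1 hp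
    exact ⟨q, ⟨y, hy, hq⟩, rfl⟩
  · rintro _ ⟨q, ⟨y, hy, hq⟩, rfl⟩
    exact ⟨_, fun i => ⟨y i, hy i, rfl⟩, (mem_span_range_map_iff j hj y).2 ⟨q, hq, rfl⟩⟩

end

section GaussMap

variable [Fintype ι] [Fintype κ]

theorem embeddedTangentSpace_map_image (X : Set (ℙ k (ι → k))) (x : ℙ k (ι → k)) :
    embeddedTangentSpace (Projectivization.map j hj '' X) (Projectivization.map j hj x) =
      (embeddedTangentSpace X x).map j := by
  obtain ⟨r, hr⟩ := j.exists_leftInverse_of_injective (LinearMap.ker_eq_bot.2 hj)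
  have hrj (v) : r (j v) = v := LinearMap.congr_fun hr v
  have hl : (LinearMap.id - j ∘ₗ r) ∘ₗ j = 0 := by
    rw [LinearMap.sub_comp, LinearMap.comp_assoc, hr, LinearMap.id_comp, LinearMap.comp_id,
      sub_self]
  induction x using Projectivization.ind with
  | h v hv =>
    rw [Projectivization.map_mk]
    apply le_antisymm
    · intro w hw
      rw [mem_embeddedTangentSpace_mk] at hw
      refine ⟨r w, mem_embeddedTangentSpace_mk.2 fun f d hf hfX => ?_, ?_⟩
      · have h := hw _ d (linearPullback_isHomogeneous r hf)
          (eval_linearPullback_leftInverse_eq_zero hj hr hf hfX)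
        rwa [aeval_dualPoint_linearPullback, hrj] at h
      · ext c
        have h := hw _ 1 (linearPullback_X_isHomogeneous _ c)
          (eval_linearPullback_X_eq_zero hj hl c X)
        rw [aeval_dualPoint_linearPullback] at h
        simpa [dualPoint, sub_eq_zero, eq_comm (a := w c)] using h
    · rintro _ ⟨w, hw, rfl⟩
      refine mem_embeddedTangentSpace_mk.2 fun f d hf hfX => ?_
      rw [← aeval_dualPoint_linearPullback]
      exact mem_embeddedTangentSpace_mk.1 hw _ d (linearPullback_isHomogeneous j hf)
        ((forall_mem_map_image_eval_eq_zero_iff j hj hf X).1 hfX)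

theorem map_mem_smoothLocus_iff (X : Set (ℙ k (ι → k))) (x : ℙ k (ι → k)) :
    Projectivization.map j hj x ∈ smoothLocus (Projectivization.map j hj '' X) ↔
      x ∈ smoothLocus X := by
  rw [smoothLocus, smoothLocus, Set.mem_ofPred_eq, Set.mem_ofPred_eq,
    (Projectivization.map_injective j hj).mem_set_image, embeddedTangentSpace_map_image,
    topologicalKrullDim_map_image, (Submodule.equivMapOfInjective j hj _).finrank_eq]

theorem gaussFiber_map_image (X : Set (ℙ k (ι → k))) (x : ℙ k (ι → k)) :
    gaussFiber (Projectivization.map j hj '' X) (Projectivization.map j hj x) =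
      Projectivization.map j hj '' gaussFiber X x := by
  have map_mem (y) : Projectivization.map j hj y ∈
      gaussFiber (Projectivization.map j hj '' X) (Projectivization.map j hj x) ↔
        y ∈ gaussFiber X x := by
    simp only [gaussFiber, Set.mem_ofPred_eq, map_mem_smoothLocus_iff hj,
      embeddedTangentSpace_map_image hj, (Submodule.map_injective_of_injective hj).eq_iff]
  apply Set.Subset.antisymm
  · intro q hq
    obtain ⟨y, -, rfl⟩ := hq.1.1
    exact ⟨y, (map_mem y).1 hq, rfl⟩
  · rintro _ ⟨y, hy, rfl⟩
    exact (map_mem y).2 hy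

theorem IsGaussDefect.map {X : Set (ℙ k (ι → k))} {δ : ℕ} (h : IsGaussDefect X δ) :
    IsGaussDefect (Projectivization.map j hj '' X) δ := by
  obtain ⟨U, hU, ⟨x, hxX, hxU⟩, hδ⟩ := h
  obtain ⟨U', hU', rfl⟩ := (isClosedEmbedding_map hj).isInducing.isOpen_iff.1 hU
  refine ⟨U', hU', ⟨_, ⟨x, hxX, rfl⟩, hxU⟩, ?_⟩
  rintro _ ⟨⟨y, hy, rfl⟩, hyU⟩
  rw [map_mem_smoothLocus_iff, gaussFiber_map_image, topologicalKrullDim_map_image]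
  exact hδ y ⟨hy, hyU⟩

end GaussMap

end LinearEmbedding

section KrullDimension

theorem ringKrullDim_le_of_isIntegral (R S : Type*) [CommRing R] [CommRing S] [Algebra R S]
    [Algebra.IsIntegral R S] : ringKrullDim S ≤ ringKrullDim R :=
  Order.krullDim_le_of_strictMono (PrimeSpectrum.comap (algebraMap R S)) fun _ _ h =>
    Ideal.IsIntegral.comap_lt_comap h

-- By Noether normalization.
theorem ringKrullDim_le_of_trdeg_le {k P : Type*} [Field k] [CommRing P] [Algebra k P]
    [Algebra.FiniteType k P] {n : ℕ} (h : Algebra.trdeg k P ≤ n) : ringKrullDim P ≤ n := by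
  cases subsingleton_or_nontrivial P
  · simp [ringKrullDim_eq_bot_of_subsingleton]
  obtain ⟨s, g, hg, hint⟩ := exists_integral_inj_algHom_of_fg k P
  have hs : s ≤ n := by
    have hx : AlgebraicIndependent k (g ∘ X) := (algebraicIndependent_X (Fin s) k).map' hg
    simpa using hx.lift_cardinalMk_le_trdeg.trans (Cardinal.lift_le.2 h)
  let := g.toRingHom.toAlgebra
  have : Algebra.IsIntegral (MvPolynomial (Fin s) k) P := ⟨hint⟩
  calc ringKrullDim P ≤ ringKrullDim (MvPolynomial (Fin s) k) := ringKrullDim_le_of_isIntegral _ _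
    _ = s := by simp
    _ ≤ n := by exact_mod_cast hs

end KrullDimension

section ConeIdeal

variable {k : Type*} [Field k] {ι : Type*}

/-- The restriction of a polynomial to the line through the origin and `v`, with the parameter
normalized to be `1` at `v`. -/
def restrictLine (v : ι → k) : MvPolynomial ι k →ₐ[k] Polynomial k :=
  aeval fun i => Polynomial.X * Polynomial.C (v i)

theorem restrictLine_of_isHomogeneous (v : ι → k) {f : MvPolynomial ι k} {d : ℕ}
    (hf : f.IsHomogeneous d) :
    restrictLine v f = Polynomial.X ^ d * Polynomial.C (eval v f) := by
  have hC : aeval (fun i => Polynomial.C (v i)) f = Polynomial.C (eval v f) := by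
    rw [← aeval_eq_eval]
    exact (comp_aeval_apply (f := v) Polynomial.CAlgHom f).symm
  rw [← hC]
  exact aeval_smul_of_isHomogeneous hf Polynomial.X _

theorem coeff_restrictLine (v : ι → k) (f : MvPolynomial ι k) (d : ℕ) :
    (restrictLine v f).coeff d = eval v (homogeneousComponent d f) := by
  conv_lhs => rw [← sum_homogeneousComponent f]
  simp only [map_sum, restrictLine_of_isHomogeneous v (homogeneousComponent_isHomogeneous _ f),
    Polynomial.finsetSum_coeff, Polynomial.coeff_X_pow_mul', Polynomial.coeff_C]
  rw [Finset.sum_eq_single d]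
  · simp
  · intro b _ hb
    split_ifs with h1 h2 <;> [omega; rfl; rfl]
  · intro h
    rw [homogeneousComponent_eq_zero _ _ (by simpa using h)]
    simp

/-- The ideal of the affine cone over a subset of projective space. -/
def coneIdeal (Z : Set (ℙ k (ι → k))) : Ideal (MvPolynomial ι k) :=
  ⨅ p ∈ Z, RingHom.ker (restrictLine p.rep)

theorem mem_coneIdeal_iff {Z : Set (ℙ k (ι → k))} {f : MvPolynomial ι k} :
    f ∈ coneIdeal Z ↔ ∀ p ∈ Z, restrictLine p.rep f = 0 := by
  simp [coneIdeal, Submodule.mem_iInf, RingHom.mem_ker]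

theorem mem_coneIdeal_iff_of_isHomogeneous {Z : Set (ℙ k (ι → k))} {f : MvPolynomial ι k} {d : ℕ}
    (hf : f.IsHomogeneous d) : f ∈ coneIdeal Z ↔ ∀ p ∈ Z, eval p.rep f = 0 := by
  simp [mem_coneIdeal_iff, restrictLine_of_isHomogeneous _ hf]

theorem coneIdeal_anti {Z W : Set (ℙ k (ι → k))} (h : Z ⊆ W) : coneIdeal W ≤ coneIdeal Z :=
  biInf_mono h

theorem exists_eval_homogeneousComponent_ne_zero {Z : Set (ℙ k (ι → k))} {f : MvPolynomial ι k}
    (hf : f ∉ coneIdeal Z) : ∃ d, ∃ p ∈ Z, eval p.rep (homogeneousComponent d f) ≠ 0 := by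
  simp only [mem_coneIdeal_iff, not_forall] at hf
  obtain ⟨p, hp, hfp⟩ := hf
  refine ⟨(restrictLine p.rep f).natDegree, p, hp, ?_⟩
  rw [← coeff_restrictLine]
  exact Polynomial.leadingCoeff_ne_zero.2 hfp

theorem coneIdeal_isPrime {Z : Set (ℙ k (ι → k))} (hZ : IsIrreducible Z) :
    (coneIdeal Z).IsPrime := by
  refine ⟨?_, fun {f g} hfg => ?_⟩
  · rw [Ideal.ne_top_iff_one, mem_coneIdeal_iff]
    intro h
    obtain ⟨p, hp⟩ := hZ.1
    simpa using h p hp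
  · by_contra! hcon
    obtain ⟨d, hd⟩ := exists_eval_homogeneousComponent_ne_zero hcon.1
    obtain ⟨e, he⟩ := exists_eval_homogeneousComponent_ne_zero hcon.2
    obtain ⟨r, hr, hrd, hre⟩ := hZ.2 _ _
      (isClosed_setOf_eval_rep_eq_zero (homogeneousComponent_isHomogeneous d f)).isOpen_compl
      (isClosed_setOf_eval_rep_eq_zero (homogeneousComponent_isHomogeneous e g)).isOpen_compl hd he
    have h := mem_coneIdeal_iff.1 hfg r hr
    rw [map_mul, mul_eq_zero] at h
    rcases h with h | h
    · exact hrd (by simpa [h] using (coeff_restrictLine r.rep f d).symm)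
    · exact hre (by simpa [h] using (coeff_restrictLine r.rep g e).symm)

theorem coneIdeal_lt_ker_eval_zero {Z : Set (ℙ k (ι → k))} (hZ : Z.Nonempty) :
    coneIdeal Z < RingHom.ker (eval (0 : ι → k)) := by
  obtain ⟨p, hp⟩ := hZ
  refine SetLike.lt_iff_le_and_exists.2 ⟨fun f hf => ?_, ?_⟩
  · have h := coeff_restrictLine p.rep f 0
    rw [mem_coneIdeal_iff.1 hf p hp, homogeneousComponent_zero, eval_C, Polynomial.coeff_zero] at h
    rw [RingHom.mem_ker, eval_zero, constantCoeff_eq, h]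
  · obtain ⟨i, hi⟩ := Function.ne_iff.1 p.rep_nonzero
    refine ⟨X i, by simp [RingHom.mem_ker], fun h => hi ?_⟩
    simpa using (mem_coneIdeal_iff_of_isHomogeneous (isHomogeneous_X k i)).1 h p hp

theorem coneIdeal_image_val_strictAnti (F : Set (ℙ k (ι → k))) :
    StrictAnti fun Z : TopologicalSpace.IrreducibleCloseds F =>
      coneIdeal ((↑) '' (Z : Set F) : Set (ℙ k (ι → k))) := by
  intro Z W h
  obtain ⟨p, hpW, hpZ⟩ := SetLike.exists_of_lt h
  obtain ⟨C, hC, hCZ⟩ := isClosed_induced_iff.1 Z.isClosed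
  obtain ⟨f, d, hf, hfC, hfp⟩ := exists_eval_ne_zero_of_notMem hC fun hp =>
    hpZ (hCZ.subset hp)
  refine SetLike.lt_iff_le_and_exists.2 ⟨coneIdeal_anti (Set.image_mono h.le), f, ?_, ?_⟩
  · rw [mem_coneIdeal_iff_of_isHomogeneous hf]
    rintro _ ⟨q, hq, rfl⟩
    exact hfC q (hCZ.superset hq)
  · rw [mem_coneIdeal_iff_of_isHomogeneous hf]
    exact fun h => hfp (h p ⟨p, hpW, rfl⟩)

-- The ideal of the vertex of the cone accounts for the additional dimension.
theorem topologicalKrullDim_add_one_le_ringKrullDim {I : Ideal (MvPolynomial ι k)}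
    {F : Set (ℙ k (ι → k))} (hF : F.Nonempty) (hI : I ≤ coneIdeal F) :
    topologicalKrullDim F + 1 ≤ ringKrullDim (MvPolynomial ι k ⧸ I) := by
  have hirr (Z : TopologicalSpace.IrreducibleCloseds F) :
      IsIrreducible ((↑) '' (Z : Set F) : Set (ℙ k (ι → k))) :=
    Z.isIrreducible.image _ continuous_subtype_val.continuousOn
  have hle (Z : TopologicalSpace.IrreducibleCloseds F) :
      I ≤ coneIdeal ((↑) '' (Z : Set F) : Set (ℙ k (ι → k))) :=
    hI.trans (coneIdeal_anti (Subtype.coe_image_subset F _))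
  obtain ⟨x⟩ := hF.to_subtype
  let Z₀ : TopologicalSpace.IrreducibleCloseds F :=
    ⟨closure {x}, isIrreducible_singleton.closure, isClosed_closure⟩
  have : Nonempty (TopologicalSpace.IrreducibleCloseds F) := ⟨Z₀⟩
  let vertex : PrimeSpectrum (MvPolynomial ι k) :=
    ⟨RingHom.ker (eval (0 : ι → k)), RingHom.ker_isPrime _⟩
  let c : WithBot (TopologicalSpace.IrreducibleCloseds F) →
      (PrimeSpectrum.zeroLocus (I : Set (MvPolynomial ι k)))ᵒᵈ := fun Z =>
    OrderDual.toDual <| Z.recBotCoe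
      ⟨vertex, (hle Z₀).trans (coneIdeal_lt_ker_eval_zero (hirr Z₀).1).le⟩
      fun Z => ⟨⟨_, coneIdeal_isPrime (hirr Z)⟩, hle Z⟩
  have hc : StrictMono c := WithBot.strictMono_iff.2
    ⟨coneIdeal_image_val_strictAnti F, fun Z => coneIdeal_lt_ker_eval_zero (hirr Z).1⟩
  rw [topologicalKrullDim, ← Order.krullDim_withBot, ringKrullDim_quotient,
    ← Order.krullDim_orderDual (α := PrimeSpectrum.zeroLocus _)]
  exact Order.krullDim_le_of_strictMono c hc

theorem topologicalKrullDim_le_of_ker_le_coneIdeal [Finite ι] {R : Type*} [CommRing R] [Algebra k R]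
    (φ : MvPolynomial ι k →ₐ[k] R) {F : Set (ℙ k (ι → k))} (hφ : RingHom.ker φ ≤ coneIdeal F)
    {d : ℕ} (hR : Algebra.trdeg k R ≤ (d + 1 : ℕ)) :
    topologicalKrullDim F ≤ ((d : ℕ∞) : WithBot ℕ∞) := by
  rcases F.eq_empty_or_nonempty with rfl | hF
  · have : IsEmpty (TopologicalSpace.IrreducibleCloseds (∅ : Set (ℙ k (ι → k)))) :=
      ⟨fun Z => Z.isIrreducible.1.elim fun x _ => x.2⟩
    simp [topologicalKrullDim, Order.krullDim_eq_bot]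
  have htrdeg : Algebra.trdeg k (MvPolynomial ι k ⧸ RingHom.ker φ) ≤ (d + 1 : ℕ) := by
    have h := lift_trdeg_le_of_injective (Ideal.kerLiftAlg φ) (Ideal.kerLiftAlg_injective φ)
    exact Cardinal.lift_le.1 (h.trans (by simpa using Cardinal.lift_le.2 hR))
  have h := (topologicalKrullDim_add_one_le_ringKrullDim hF hφ).trans
    (ringKrullDim_le_of_trdeg_le htrdeg)
  exact (ENat.WithBot.add_le_add_one_right_iff).1 (by exact_mod_cast h)

end ConeIdeal

section GroupAlgebra

variable {k : Type*} [Field k] {Λ : Type*} [AddCommGroup Λ]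

/-- Evaluation of a regular function on the torus at a closed point. -/
def torusEval (t : Torus k Λ) : AddMonoidAlgebra k Λ →ₐ[k] k :=
  AddMonoidAlgebra.lift k k Λ ((Units.coeHom k).comp t)

@[simp]
theorem torusEval_single (t : Torus k Λ) (m : Λ) (c : k) :
    torusEval t (AddMonoidAlgebra.single m c) = c * t (Multiplicative.ofAdd m) := by
  simp [torusEval]

variable [Module.Free ℤ Λ]

theorem exists_torus_apply_ne_one [CharZero k] {m : Λ} (hm : m ≠ 0) :
    ∃ t : Torus k Λ, t (Multiplicative.ofAdd m) ≠ 1 := by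
  let b := Module.Free.chooseBasis ℤ Λ
  obtain ⟨i, hi⟩ : ∃ i, b.repr m i ≠ 0 := by
    by_contra! h
    exact hm (b.repr.map_eq_zero_iff.1 (Finsupp.ext h))
  refine ⟨(zpowersHom kˣ (Units.mk0 2 two_ne_zero)).comp
    (AddMonoidHom.toMultiplicative (b.coord i).toAddMonoidHom), fun h => hi ?_⟩
  have h₂ : (2 : k) ^ b.repr m i = 1 := by
    simpa [zpowersHom_apply] using congrArg Units.val h
  have h₂' : (2 : ℚ) ^ b.repr m i = 1 := by
    apply Rat.cast_injective (α := k)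
    simpa using h₂
  exact (zpow_eq_one_iff_right₀ zero_le_two (by norm_num)).1 h₂'

theorem linearIndependent_torus_apply [CharZero k] :
    LinearIndependent k fun (m : Λ) (t : Torus k Λ) => (t (Multiplicative.ofAdd m) : k) := by
  let χ (m : Λ) : Torus k Λ →* k :=
    (Units.coeHom k).comp (MonoidHom.eval (Multiplicative.ofAdd m))
  refine (linearIndependent_monoidHom (Torus k Λ) k).comp χ fun m m' h => ?_
  by_contra hne
  obtain ⟨t, ht⟩ := exists_torus_apply_ne_one (k := k) (sub_ne_zero.2 hne)
  have hm : t (Multiplicative.ofAdd m) = t (Multiplicative.ofAdd m') :=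
    Units.ext (DFunLike.congr_fun h t)
  exact ht (by rw [ofAdd_sub, map_div, hm, div_self'])

theorem eq_zero_of_torusEval_eq_zero [CharZero k] {F : AddMonoidAlgebra k Λ}
    (hF : ∀ t : Torus k Λ, torusEval t F = 0) : F = 0 := by
  rw [← AddMonoidAlgebra.coeff_eq_zero]
  refine linearIndependent_iff.1 (linearIndependent_torus_apply (k := k)) _ (funext fun t => ?_)
  simpa [Finsupp.linearCombination_apply, Finsupp.sum_apply', torusEval,
    AddMonoidAlgebra.lift_apply] using hF t

instance : IsDomain (AddMonoidAlgebra k Λ) :=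
  have : TwoUniqueSums Λ :=
    TwoUniqueSums.of_injective_addHom _ (Module.Free.chooseBasis ℤ Λ).repr.injective inferInstance
  NoZeroDivisors.to_isDomain _

theorem isAlgebraic_single {S : Subalgebra k (AddMonoidAlgebra k Λ)} {G : Set Λ}
    (hG : ∀ m ∈ G, AddMonoidAlgebra.single m 1 ∈ S) {m : Λ} (hm : m ∈ AddSubgroup.closure G)
    (c : k) : IsAlgebraic S (AddMonoidAlgebra.single m c) := by
  have hm₁ : IsAlgebraic S (AddMonoidAlgebra.single m (1 : k)) := by
    induction hm using AddSubgroup.closure_induction with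
    | mem m hm => exact isAlgebraic_algebraMap (⟨_, hG m hm⟩ : S)
    | zero => exact isAlgebraic_one
    | add m m' _ _ hm hm' =>
      simpa only [AddMonoidAlgebra.single_mul_single, mul_one] using hm.mul hm'
    | neg m _ hm =>
      let : Invertible (AddMonoidAlgebra.single m (1 : k)) :=
        ⟨AddMonoidAlgebra.single (-m) 1,
          by simp [AddMonoidAlgebra.single_mul_single, AddMonoidAlgebra.one_def],
          by simp [AddMonoidAlgebra.single_mul_single, AddMonoidAlgebra.one_def]⟩
      exact IsAlgebraic.invOf hm
  have hc : IsAlgebraic S (algebraMap k (AddMonoidAlgebra k Λ) c) :=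
    isAlgebraic_algebraMap (algebraMap k S c)
  simpa [← Algebra.smul_def, AddMonoidAlgebra.smul_single] using hc.mul hm₁

theorem trdeg_addMonoidAlgebra_le [Module.Finite ℤ Λ] :
    Algebra.trdeg k (AddMonoidAlgebra k Λ) ≤ Module.finrank ℤ Λ := by
  let b := Module.finBasis ℤ Λ
  let x i : AddMonoidAlgebra k Λ := AddMonoidAlgebra.single (b i) 1
  have hb : AddSubgroup.closure (Set.range b) = ⊤ := by
    rw [← Submodule.span_int_eq_addSubgroupClosure, b.span_eq, Submodule.top_toAddSubgroup]
  have : Algebra.IsAlgebraic (Algebra.adjoin k (Set.range x)) (AddMonoidAlgebra k Λ) := by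
    refine ⟨fun F => ?_⟩
    induction F using AddMonoidAlgebra.induction_linear with
    | zero => exact isAlgebraic_zero
    | add f g hf hg => exact hf.add hg
    | single m c =>
      refine isAlgebraic_single (G := Set.range b) ?_ (hb ▸ AddSubgroup.mem_top m) c
      rintro _ ⟨i, rfl⟩
      exact Algebra.subset_adjoin ⟨i, rfl⟩
  calc Algebra.trdeg k (AddMonoidAlgebra k Λ) ≤ Cardinal.mk (Set.range x) :=
        Algebra.IsAlgebraic.trdeg_le_cardinalMk k _
    _ ≤ Module.finrank ℤ Λ := by simpa using Cardinal.mk_range_le_lift (f := x)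

end GroupAlgebra

section Orbits

variable {k : Type*} [Field k] {Λ : Type*} [AddCommGroup Λ] {ι : Type*}

/-- The diagonal linear map by which a point of the torus acts with weights `a`. -/
def weightedScale (a : ι → Λ) (t : Torus k Λ) : (ι → k) ≃ₗ[k] (ι → k) :=
  LinearEquiv.piCongrRight fun u => LinearEquiv.smulOfUnit (M := k) (t (Multiplicative.ofAdd (a u)))

@[simp]
theorem weightedScale_apply (a : ι → Λ) (t : Torus k Λ) (v : ι → k) (u : ι) :
    weightedScale a t v u = t (Multiplicative.ofAdd (a u)) * v u := rfl

/-- The action of the torus on projective space with weights `a`. -/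
def weightedAction (a : ι → Λ) (t : Torus k Λ) : ℙ k (ι → k) → ℙ k (ι → k) :=
  Projectivization.map (weightedScale a t).toLinearMap (weightedScale a t).injective

theorem weightedAction_mk (a : ι → Λ) (t : Torus k Λ) (v : ι → k) (hv : v ≠ 0) :
    weightedAction a t (Projectivization.mk k v hv) = Projectivization.mk k (weightedScale a t v)
      ((weightedScale a t).map_ne_zero_iff.2 hv) := rfl

theorem weightedAction_mul (a : ι → Λ) (s t : Torus k Λ) (p : ℙ k (ι → k)) :
    weightedAction a (s * t) p = weightedAction a s (weightedAction a t p) := by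
  induction p using Projectivization.ind with
  | h v hv =>
    simp only [weightedAction_mk]
    congr 1
    ext u
    simp [mul_assoc]

@[simp]
theorem weightedAction_one (a : ι → Λ) (p : ℙ k (ι → k)) : weightedAction a 1 p = p := by
  induction p using Projectivization.ind with
  | h v hv =>
    simp only [weightedAction_mk]
    congr 1
    ext u
    simp

/-- The orbit of a point under the torus acting with weights `a`. -/
def orbit (a : ι → Λ) (p : ℙ k (ι → k)) : Set (ℙ k (ι → k)) :=
  Set.range fun t : Torus k Λ => weightedAction a t p

theorem mem_orbit_self (a : ι → Λ) (p : ℙ k (ι → k)) : p ∈ orbit a p := ⟨1, weightedAction_one a p⟩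

theorem weightedAction_mem_orbit {a : ι → Λ} {p q : ℙ k (ι → k)} (t : Torus k Λ)
    (hq : q ∈ orbit a p) : weightedAction a t q ∈ orbit a p := by
  obtain ⟨s, rfl⟩ := hq
  exact ⟨t * s, weightedAction_mul a t s p⟩

theorem weightedAction_mem_closure_orbit [Finite ι] {a : ι → Λ} {p q : ℙ k (ι → k)}
    (t : Torus k Λ) (hq : q ∈ closure (orbit a p)) : weightedAction a t q ∈ closure (orbit a p) :=
  map_mem_closure (continuous_map _ _) hq fun _ => weightedAction_mem_orbit t

theorem orbit_comp_subset {Γ : Type*} [AddCommGroup Γ] (l : Λ →+ Γ) (a : ι → Λ)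
    (p : ℙ k (ι → k)) : orbit (l ∘ a) p ⊆ orbit a p := by
  rintro _ ⟨t, rfl⟩
  exact ⟨t.comp (AddMonoidHom.toMultiplicative l), rfl⟩

/-- Pullback of polynomials to regular functions on the torus along `t ↦ (t ^ a u * c u)`. -/
def orbitPullback (a : ι → Λ) (c : ι → k) : MvPolynomial ι k →ₐ[k] AddMonoidAlgebra k Λ :=
  aeval fun u => AddMonoidAlgebra.single (a u) (c u)

theorem torusEval_orbitPullback (a : ι → Λ) (c : ι → k) (t : Torus k Λ) (f : MvPolynomial ι k) :
    torusEval t (orbitPullback a c f) = eval (weightedScale a t c) f := by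
  rw [orbitPullback, comp_aeval_apply, ← aeval_eq_eval]
  congr 2
  ext u
  simp [mul_comm]

theorem eval_rep_weightedAction_eq_zero_iff {f : MvPolynomial ι k} {d : ℕ} (hf : f.IsHomogeneous d)
    (a : ι → Λ) (t : Torus k Λ) {c : ι → k} (hc : c ≠ 0) :
    eval (weightedAction a t (Projectivization.mk k c hc)).rep f = 0 ↔
      torusEval t (orbitPullback a c f) = 0 := by
  rw [weightedAction_mk, eval_rep_mk_eq_zero_iff hf, torusEval_orbitPullback]

variable [CharZero k] [Module.Free ℤ Λ]

theorem isIrreducible_orbit (a : ι → Λ) (p : ℙ k (ι → k)) : IsIrreducible (orbit a p) := by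
  refine ⟨⟨p, mem_orbit_self a p⟩, ?_⟩
  induction p using Projectivization.ind with
  | h c hc =>
    rintro U V hU hV ⟨_, ⟨s, rfl⟩, hs⟩ ⟨_, ⟨t, rfl⟩, ht⟩
    obtain ⟨f, d, hf, hfU, hfs⟩ := exists_eval_ne_zero_of_notMem hU.isClosed_compl (not_not.2 hs)
    obtain ⟨g, e, hg, hgV, hgt⟩ := exists_eval_ne_zero_of_notMem hV.isClosed_compl (not_not.2 ht)
    rw [Ne, eval_rep_weightedAction_eq_zero_iff hf] at hfs
    rw [Ne, eval_rep_weightedAction_eq_zero_iff hg] at hgt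
    obtain ⟨r, hr⟩ : ∃ r, torusEval r (orbitPullback a c f * orbitPullback a c g) ≠ 0 := by
      by_contra! h
      exact mul_ne_zero (ne_zero_of_map hfs) (ne_zero_of_map hgt) (eq_zero_of_torusEval_eq_zero h)
    rw [map_mul, mul_ne_zero_iff] at hr
    refine ⟨_, ⟨r, rfl⟩, not_not.1 fun h => hr.1 ?_, not_not.1 fun h => hr.2 ?_⟩
    · exact (eval_rep_weightedAction_eq_zero_iff hf a r hc).1 (hfU _ h)
    · exact (eval_rep_weightedAction_eq_zero_iff hg a r hc).1 (hgV _ h)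

theorem orbitPullback_eq_zero {a : ι → Λ} {c : ι → k} {hc : c ≠ 0} {f : MvPolynomial ι k}
    {d : ℕ} (hf : f.IsHomogeneous d)
    (hfa : ∀ q ∈ orbit a (Projectivization.mk k c hc), eval q.rep f = 0) :
    orbitPullback a c f = 0 :=
  eq_zero_of_torusEval_eq_zero fun t =>
    (eval_rep_weightedAction_eq_zero_iff hf a t hc).1 (hfa _ ⟨t, rfl⟩)

end Orbits

section Binomials

variable {k : Type*} [Field k] {Λ : Type*} [AddCommGroup Λ] {ι : Type*}

/-- The weights lie on an affine hyperplane at height one, so that the binomials they define are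
homogeneous. -/
def IsAtHeightOne (a : ι → Λ) : Prop :=
  ∃ h : Λ →ₗ[ℤ] ℤ, ∀ u, h (a u) = 1

theorem weight_comp {Γ : Type*} [AddCommGroup Γ] (l : Λ →+ Γ) (a : ι → Λ) (α : ι →₀ ℕ) :
    Finsupp.weight (l ∘ a) α = l (Finsupp.weight a α) := by
  simp [Finsupp.weight_apply, map_finsuppSum]

theorem map_weight {h : Λ →ₗ[ℤ] ℤ} {a : ι → Λ} (ha : ∀ u, h (a u) = 1) (α : ι →₀ ℕ) :
    h (Finsupp.weight a α) = α.degree := by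
  simp [Finsupp.weight_apply, Finsupp.sum, ha, Finsupp.degree_apply]

theorem IsAtHeightOne.degree_eq {a : ι → Λ} (ha : IsAtHeightOne a) {α β : ι →₀ ℕ}
    (hαβ : Finsupp.weight a α = Finsupp.weight a β) : α.degree = β.degree := by
  obtain ⟨h, hh⟩ := ha
  have := congrArg h hαβ
  rw [map_weight hh, map_weight hh] at this
  exact_mod_cast this

/-- The point `w` satisfies the binomial equations of the toric variety with weights `a`: the value
of a monomial at `w` depends on its weight only. -/
def SatisfiesBinomials (a : ι → Λ) {R : Type*} [CommSemiring R] (w : ι → R) : Prop :=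
  Function.FactorsThrough (fun α : ι →₀ ℕ => α.prod fun u n => w u ^ n) (Finsupp.weight a)

theorem SatisfiesBinomials.smul {a : ι → Λ} (ha : IsAtHeightOne a) {R : Type*} [CommSemiring R]
    {w : ι → R} (hw : SatisfiesBinomials a w) (c : R) : SatisfiesBinomials a (c • w) := by
  intro α β hαβ
  have h (α : ι →₀ ℕ) : (α.prod fun u n => (c • w) u ^ n) =
      c ^ α.degree * α.prod fun u n => w u ^ n := by
    simp [Finsupp.prod, mul_pow, Finset.prod_mul_distrib, Finset.prod_pow_eq_pow_sum,
      Finsupp.degree_apply]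
  simp only [h, hw hαβ, ha.degree_eq hαβ]

theorem prod_torus_pow (a : ι → Λ) (t : Torus k Λ) (α : ι →₀ ℕ) :
    (α.prod fun u n => (t (Multiplicative.ofAdd (a u)) : k) ^ n) =
      t (Multiplicative.ofAdd (Finsupp.weight a α)) := by
  simp [Finsupp.weight_apply, Finsupp.prod, Finsupp.sum, ofAdd_sum, ofAdd_nsmul]

theorem SatisfiesBinomials.weightedScale {a : ι → Λ} (t : Torus k Λ) {v : ι → k}
    (hv : SatisfiesBinomials a v) : SatisfiesBinomials a (weightedScale a t v) := by
  intro α β hαβ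
  simp only [weightedScale_apply, mul_pow, Finsupp.prod_mul, prod_torus_pow, hαβ, hv hαβ]

theorem orbitPullback_monomial (a : ι → Λ) (c : ι → k) (α : ι →₀ ℕ) (r : k) :
    orbitPullback a c (monomial α r) =
      AddMonoidAlgebra.single (Finsupp.weight a α) (r * α.prod fun u n => c u ^ n) := by
  simp [orbitPullback, aeval_monomial, AddMonoidAlgebra.single_pow, Finsupp.weight_apply]

-- The toric ideal is spanned by binomials, so that it vanishes where the binomials do.
theorem SatisfiesBinomials.aeval_eq_zero {R : Type*} [CommSemiring R] [Algebra k R] {a : ι → Λ}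
    {w : ι → R} (hw : SatisfiesBinomials a w) {f : MvPolynomial ι k}
    (hf : orbitPullback a 1 f = 0) : aeval w f = 0 := by
  let c : Λ → R := Function.extend (Finsupp.weight a) (fun α => α.prod fun u n => w u ^ n) 0
  let ψ : AddMonoidAlgebra k Λ →ₗ[k] R :=
    Finsupp.linearCombination k c ∘ₗ (AddMonoidAlgebra.coeffLinearEquiv k).toLinearMap
  have hψ : ψ ∘ₗ (orbitPullback a 1).toLinearMap = (aeval w).toLinearMap := by
    refine (basisMonomials ι k).ext fun α => ?_
    simp [orbitPullback_monomial, aeval_monomial, ψ, c, hw.extend_apply]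
  simpa [hf] using (LinearMap.congr_fun hψ f).symm

/-- The common zeros of the binomials of the toric variety with weights `a`. -/
def binomialLocus (k : Type*) [Field k] (a : ι → Λ) : Set (ℙ k (ι → k)) :=
  {p | SatisfiesBinomials a p.rep}

theorem mk_mem_binomialLocus_iff {a : ι → Λ} (ha : IsAtHeightOne a) {v : ι → k} {hv : v ≠ 0} :
    Projectivization.mk k v hv ∈ binomialLocus k a ↔ SatisfiesBinomials a v := by
  obtain ⟨c, hc⟩ := Projectivization.exists_smul_eq_mk_rep k v hv
  rw [binomialLocus, Set.mem_ofPred_eq, ← hc]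
  exact ⟨fun h => by simpa [Units.smul_def] using h.smul ha ↑c⁻¹, fun h => h.smul ha (c : k)⟩

theorem weightedAction_mem_binomialLocus {a : ι → Λ} (ha : IsAtHeightOne a) (t : Torus k Λ)
    {p : ℙ k (ι → k)} (hp : p ∈ binomialLocus k a) : weightedAction a t p ∈ binomialLocus k a := by
  induction p using Projectivization.ind with
  | h v hv =>
    rw [mk_mem_binomialLocus_iff ha] at hp
    exact (mk_mem_binomialLocus_iff ha).2 (hp.weightedScale t)

theorem weightedAction_image_binomialLocus {a : ι → Λ} (ha : IsAtHeightOne a) (t : Torus k Λ) :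
    weightedAction a t '' binomialLocus k a = binomialLocus k a := by
  refine (Set.image_subset_iff.2 fun p => weightedAction_mem_binomialLocus ha t).antisymm
    fun p hp => ⟨_, weightedAction_mem_binomialLocus ha t⁻¹ hp, ?_⟩
  rw [← weightedAction_mul, show t * t⁻¹ = 1 from mul_inv_cancel t, weightedAction_one]

theorem eval_monomial_sub_monomial (v : ι → k) (α β : ι →₀ ℕ) :
    eval v (monomial α 1 - monomial β 1) =
      (α.prod fun u n => v u ^ n) - β.prod fun u n => v u ^ n := by
  simp [eval_monomial]

theorem isHomogeneous_monomial_sub_monomial {α β : ι →₀ ℕ} (h : α.degree = β.degree) :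
    (monomial α 1 - monomial β 1 : MvPolynomial ι k).IsHomogeneous β.degree :=
  (isHomogeneous_monomial _ h).sub (isHomogeneous_monomial _ rfl)

theorem isClosed_binomialLocus {a : ι → Λ} (ha : IsAtHeightOne a) :
    IsClosed (binomialLocus k a) := by
  have : binomialLocus k a =
      ⋂ (α : ι →₀ ℕ) (β : ι →₀ ℕ) (_ : Finsupp.weight a α = Finsupp.weight a β),
        {p : ℙ k (ι → k) | eval p.rep (monomial α 1 - monomial β 1) = 0} := by
    ext p
    simp only [binomialLocus, SatisfiesBinomials, Function.FactorsThrough, Set.mem_iInter,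
      Set.mem_ofPred_eq, eval_monomial_sub_monomial, sub_eq_zero]
  rw [this]
  exact isClosed_iInter fun α => isClosed_iInter fun β => isClosed_iInter fun hαβ =>
    isClosed_setOf_eval_rep_eq_zero (isHomogeneous_monomial_sub_monomial (ha.degree_eq hαβ))

variable [Nonempty ι]

variable (k ι) in
/-- The point all of whose coordinates are `1`. -/
def unitPoint : ℙ k (ι → k) := Projectivization.mk k (1 : ι → k) one_ne_zero

theorem orbit_unitPoint_subset_binomialLocus {a : ι → Λ} (ha : IsAtHeightOne a) :
    orbit a (unitPoint k ι) ⊆ binomialLocus k a := by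
  rintro _ ⟨t, rfl⟩
  exact weightedAction_mem_binomialLocus ha t
    ((mk_mem_binomialLocus_iff ha).2 fun α β _ => by simp)

theorem closure_orbit_unitPoint [CharZero k] [Module.Free ℤ Λ] {a : ι → Λ}
    (ha : IsAtHeightOne a) : closure (orbit a (unitPoint k ι)) = binomialLocus k a := by
  refine (closure_minimal (orbit_unitPoint_subset_binomialLocus ha)
    (isClosed_binomialLocus ha)).antisymm fun p hp => mem_closure_iff_eval.2 fun f d hf hfa => ?_
  rw [← aeval_eq_eval]
  exact SatisfiesBinomials.aeval_eq_zero hp (orbitPullback_eq_zero hf hfa)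

end Binomials

section Dimension

theorem isIrreducible_range_inclusion {T : Type*} [TopologicalSpace T] {W F : Set T} (h : W ⊆ F)
    (hW : IsIrreducible W) : IsIrreducible (Set.range (Set.inclusion h)) := by
  have := Subtype.irreducibleSpace hW
  rw [← Set.image_univ]
  exact (IrreducibleSpace.isIrreducible_univ W).image _ (continuous_inclusion h).continuousOn

theorem le_topologicalKrullDim_of_chain {T : Type*} [TopologicalSpace T] {F : Set T} {d : ℕ}
    (W : Fin (d + 1) → Set T) (hWF : ∀ i, W i ⊆ F) (hirr : ∀ i, IsIrreducible (W i))
    (hmono : ∀ i : Fin d, W i.castSucc ⊆ W i.succ)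
    (hsep : ∀ i : Fin d, ∃ C, IsClosed C ∧ W i.castSucc ⊆ C ∧ ¬ W i.succ ⊆ C) :
    ((d : ℕ∞) : WithBot ℕ∞) ≤ topologicalKrullDim F := by
  let Z (i : Fin (d + 1)) : TopologicalSpace.IrreducibleCloseds F :=
    ⟨closure (Set.range (Set.inclusion (hWF i))),
      (isIrreducible_range_inclusion (hWF i) (hirr i)).closure, isClosed_closure⟩
  have hZ (i : Fin d) : Z i.castSucc < Z i.succ := by
    obtain ⟨C, hC, hCi, hCi'⟩ := hsep i
    refine SetLike.lt_iff_le_and_exists.2 ⟨?_, ?_⟩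
    · exact closure_mono (Set.range_subset_iff.2 fun x => ⟨⟨x, hmono i x.2⟩, rfl⟩)
    · obtain ⟨x, hx, hxC⟩ := Set.not_subset.1 hCi'
      refine ⟨⟨x, hWF _ hx⟩, subset_closure ⟨⟨x, hx⟩, rfl⟩, fun h => hxC ?_⟩
      exact closure_minimal (t := (↑) ⁻¹' C) (Set.range_subset_iff.2 fun y => hCi y.2)
        (hC.preimage continuous_subtype_val) h
  exact Order.LTSeries.length_le_krullDim ⟨d, Z, hZ⟩

variable {k : Type*} [Field k] {Λ : Type*} [AddCommGroup Λ] {ι : Type*}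

theorem topologicalKrullDim_le_of_subset_binomialLocus [Finite ι] [Module.Free ℤ Λ]
    [Module.Finite ℤ Λ] {a : ι → Λ} (ha : IsAtHeightOne a) {d : ℕ}
    (hd : Module.finrank ℤ Λ = d + 1) {F : Set (ℙ k (ι → k))} (hF : F ⊆ binomialLocus k a) :
    topologicalKrullDim F ≤ ((d : ℕ∞) : WithBot ℕ∞) := by
  refine topologicalKrullDim_le_of_ker_le_coneIdeal (orbitPullback a 1) (fun f hf => ?_)
    (hd ▸ trdeg_addMonoidAlgebra_le)
  refine mem_coneIdeal_iff.2 fun p hp => SatisfiesBinomials.aeval_eq_zero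
    (SatisfiesBinomials.smul ha (fun α β hαβ => ?_) Polynomial.X) hf
  simpa [Finsupp.prod] using congrArg Polynomial.C (hF hp hαβ)

theorem exists_weight_sub_weight_eq {a : ι → Λ} (hspan : Submodule.span ℤ (Set.range a) = ⊤)
    (m : Λ) : ∃ α β : ι →₀ ℕ, Finsupp.weight a α - Finsupp.weight a β = m := by
  obtain ⟨c, rfl⟩ := Finsupp.mem_span_range_iff_exists_finsupp.1
    (hspan ▸ Submodule.mem_top : m ∈ Submodule.span ℤ (Set.range a))
  refine ⟨c.mapRange Int.toNat rfl, c.mapRange (fun n => (-n).toNat) rfl, ?_⟩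
  simp only [Finsupp.weight_apply, Finsupp.sum_mapRange_index, zero_smul, implies_true,
    ← Finsupp.sum_sub]
  refine Finsupp.sum_congr fun u _ => ?_
  rw [← natCast_zsmul, ← natCast_zsmul, ← sub_smul, Int.toNat_sub_toNat_neg]

theorem finrank_ker_add_one [Module.Finite ℤ Λ] {h : Λ →ₗ[ℤ] ℤ}
    (hh : Function.Surjective h) :
    Module.finrank ℤ (LinearMap.ker h) + 1 = Module.finrank ℤ Λ := by
  rw [← (LinearMap.ker h).finrank_quotient_add_finrank,
    (h.quotKerEquivOfSurjective hh).finrank_eq, Module.finrank_self, add_comm]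

theorem exists_linearMap_surjective_on_ker [Module.Free ℤ Λ] [Module.Finite ℤ Λ]
    {h : Λ →ₗ[ℤ] ℤ} {m₀ : Λ} (hm₀ : h m₀ = 1) {d : ℕ} (hd : Module.finrank ℤ Λ = d + 1) :
    ∃ π : Λ →ₗ[ℤ] (Fin d → ℤ), ∀ v, ∃ m, h m = 0 ∧ π m = v := by
  have hK := finrank_ker_add_one (h := h) fun n => ⟨n • m₀, by simp [hm₀]⟩
  let b := Module.finBasisOfFinrankEq ℤ (LinearMap.ker h) (by omega : _ = d)
  let q : Λ →ₗ[ℤ] LinearMap.ker h :=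
    (LinearMap.id - h.smulRight m₀).codRestrict _ fun m => by simp [hm₀]
  have hq (m : LinearMap.ker h) : q m = m := by
    refine Subtype.ext ?_
    change (m : Λ) - h m • m₀ = m
    rw [LinearMap.mem_ker.1 m.2, zero_smul, sub_zero]
  refine ⟨b.equivFun ∘ₗ q, fun v => ⟨b.equivFun.symm v, ?_, ?_⟩⟩
  · exact (b.equivFun.symm v).2
  · simp only [LinearMap.comp_apply, hq, LinearEquiv.coe_coe, LinearEquiv.apply_symm_apply]

/-- The endomorphism of `ℤ^d` that keeps the first `i` coordinates and kills the others. -/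
def truncation (d i : ℕ) : (Fin d → ℤ) →ₗ[ℤ] (Fin d → ℤ) :=
  LinearMap.pi fun j => if (j : ℕ) < i then LinearMap.proj j else 0

theorem truncation_single (d i : ℕ) (j : Fin d) :
    truncation d i (Pi.single j 1) = if (j : ℕ) < i then Pi.single j 1 else 0 := by
  ext l
  rcases eq_or_ne l j with rfl | hl
  · by_cases h : (l : ℕ) < i <;> simp [truncation, h]
  · by_cases h : (l : ℕ) < i <;> by_cases h' : (j : ℕ) < i <;> simp [truncation, h, h', hl]

theorem truncation_comp_truncation_succ (d i : ℕ) :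
    truncation d i ∘ₗ truncation d (i + 1) = truncation d i := by
  ext j : 1
  ext : 1
  simp only [LinearMap.comp_apply, LinearMap.single_apply, truncation_single]
  split_ifs <;> simp [truncation_single] <;> omega

variable [Nonempty ι]

theorem eval_rep_weightedAction_unitPoint_eq_zero_iff {Γ : Type*} [AddCommGroup Γ] (a : ι → Λ)
    {α β : ι →₀ ℕ} (hdeg : α.degree = β.degree) (l : Λ →+ Γ) (t : Torus k Γ) :
    eval (weightedAction (l ∘ a) t (unitPoint k ι)).rep (monomial α 1 - monomial β 1) = 0 ↔
      t (Multiplicative.ofAdd (l (Finsupp.weight a α - Finsupp.weight a β))) = 1 := by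
  rw [unitPoint, eval_rep_weightedAction_eq_zero_iff (isHomogeneous_monomial_sub_monomial hdeg),
    map_sub, orbitPullback_monomial, orbitPullback_monomial, weight_comp, weight_comp, map_sub]
  simp [sub_eq_zero, div_eq_one, Units.val_inj]

variable [CharZero k] [Module.Free ℤ Λ] [Module.Finite ℤ Λ]

-- The orbits under the subtori of the first `i` coordinates form a chain of length `d`.
theorem le_topologicalKrullDim_of_orbit_subset {a : ι → Λ} (ha : IsAtHeightOne a)
    (hspan : Submodule.span ℤ (Set.range a) = ⊤) {d : ℕ} (hd : Module.finrank ℤ Λ = d + 1)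
    {F : Set (ℙ k (ι → k))} (hF : orbit a (unitPoint k ι) ⊆ F) :
    ((d : ℕ∞) : WithBot ℕ∞) ≤ topologicalKrullDim F := by
  obtain ⟨h, hh⟩ := ha
  obtain ⟨π, hπ⟩ := exists_linearMap_surjective_on_ker (hh (Classical.arbitrary ι)) hd
  let l (i : ℕ) : Λ →+ (Fin d → ℤ) := (truncation d i ∘ₗ π).toAddMonoidHom
  refine le_topologicalKrullDim_of_chain (fun i => orbit (l i ∘ a) (unitPoint k ι))
    (fun i => (orbit_comp_subset _ _ _).trans hF) (fun i => isIrreducible_orbit _ _)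
    (fun i => ?_) fun i => ?_
  · have hl : l i = (truncation d i).toAddMonoidHom.comp (l (i + 1)) :=
      AddMonoidHom.ext fun m => (LinearMap.congr_fun (truncation_comp_truncation_succ d i) _).symm
    rw [Fin.val_castSucc, Fin.val_succ, hl, AddMonoidHom.coe_comp, Function.comp_assoc]
    exact orbit_comp_subset _ _ _
  · obtain ⟨m, hm, hπm⟩ := hπ (Pi.single i 1)
    obtain ⟨α, β, hαβ⟩ := exists_weight_sub_weight_eq hspan m
    have hdeg : α.degree = β.degree := by
      rw [← hαβ, map_sub, map_weight hh, map_weight hh, sub_eq_zero] at hm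
      exact_mod_cast hm
    have heval n t := eval_rep_weightedAction_unitPoint_eq_zero_iff (k := k) a hdeg (l n) t
    have hl n : l n m = truncation d n (Pi.single i 1) := congrArg (truncation d n) hπm
    simp only [hαβ, hl, truncation_single] at heval
    refine ⟨_, isClosed_setOf_eval_rep_eq_zero (isHomogeneous_monomial_sub_monomial hdeg), ?_,
      fun hsub => ?_⟩
    · rintro _ ⟨t, rfl⟩
      exact (heval _ t).2 (by simp)
    · obtain ⟨t, ht⟩ := exists_torus_apply_ne_one (k := k) (Λ := Fin d → ℤ)
        (m := Pi.single i 1) (by simp)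
      exact ht (by simpa using (heval _ t).1 (hsub ⟨t, rfl⟩))

theorem topologicalKrullDim_eq_of_orbit_subset [Finite ι] {a : ι → Λ} (ha : IsAtHeightOne a)
    (hspan : Submodule.span ℤ (Set.range a) = ⊤) {d : ℕ} (hd : Module.finrank ℤ Λ = d + 1)
    {F : Set (ℙ k (ι → k))} (hF : orbit a (unitPoint k ι) ⊆ F) (hF' : F ⊆ binomialLocus k a) :
    topologicalKrullDim F = ((d : ℕ∞) : WithBot ℕ∞) :=
  le_antisymm (topologicalKrullDim_le_of_subset_binomialLocus ha hd hF')
    (le_topologicalKrullDim_of_orbit_subset ha hspan hd hF)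

end Dimension

section Tangent

variable {k : Type*} [Field k] {Λ : Type*} [AddCommGroup Λ] {ι : Type*}

variable (k) in
/-- The evaluation of linear functions at the weights `a`; its range is the embedded tangent space
at the unit point of the toric variety with weights `a`. -/
def weightMap (a : ι → Λ) : (Λ →ₗ[ℤ] k) →ₗ[k] (ι → k) where
  toFun l u := l (a u)
  map_add' _ _ := rfl
  map_smul' _ _ := rfl

@[simp]
theorem weightMap_apply (a : ι → Λ) (l : Λ →ₗ[ℤ] k) (u : ι) : weightMap k a l u = l (a u) := rfl

theorem weightMap_injective {a : ι → Λ} (hspan : Submodule.span ℤ (Set.range a) = ⊤) :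
    Function.Injective (weightMap k a) := fun _ _ h =>
  LinearMap.ext_on hspan (Set.forall_mem_range.2 fun u => congrFun h u)

theorem finrank_range_weightMap [Module.Free ℤ Λ] [Module.Finite ℤ Λ] {a : ι → Λ}
    (hspan : Submodule.span ℤ (Set.range a) = ⊤) :
    Module.finrank k (LinearMap.range (weightMap k a)) = Module.finrank ℤ Λ := by
  rw [LinearMap.finrank_range_of_inj (weightMap_injective hspan),
    ← ((Module.finBasis ℤ Λ).constr (M' := k) k).finrank_eq, Module.finrank_fin_fun]

theorem exists_addMonoidHom_of_factorsThrough {a : ι → Λ}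
    (hspan : Submodule.span ℤ (Set.range a) = ⊤) {H : Type*} [AddCommGroup H] {w : ι → H}
    (hw : Function.FactorsThrough (Finsupp.weight (R := ℕ) w) (Finsupp.weight a)) :
    ∃ l : Λ →+ H, ∀ u, l (a u) = w u := by
  choose α β hαβ using exists_weight_sub_weight_eq hspan
  have weight_sub_eq (γ δ : ι →₀ ℕ) (m : Λ) (hm : Finsupp.weight a γ - Finsupp.weight a δ = m) :
      Finsupp.weight w (α m) - Finsupp.weight w (β m) =
        Finsupp.weight w γ - Finsupp.weight w δ := by
    rw [sub_eq_sub_iff_add_eq_add, ← map_add, ← map_add]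
    apply hw
    rw [map_add, map_add, ← sub_eq_sub_iff_add_eq_add, hαβ, hm]
  refine ⟨AddMonoidHom.mk' (fun m => Finsupp.weight w (α m) - Finsupp.weight w (β m))
    fun m m' => ?_, fun u => ?_⟩
  · rw [weight_sub_eq (α m + α m') (β m + β m') (m + m')] <;>
      simp only [map_add, add_sub_add_comm, hαβ]
  · refine (weight_sub_eq (Finsupp.single u 1) 0 (a u) ?_).trans ?_ <;> simp [Finsupp.weight_apply]

theorem exists_weightedScale_one_eq {a : ι → Λ} (hspan : Submodule.span ℤ (Set.range a) = ⊤)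
    {v : ι → k} (hv : SatisfiesBinomials a v) (hv0 : ∀ u, v u ≠ 0) :
    ∃ t : Torus k Λ, weightedScale a t 1 = v := by
  obtain ⟨l, hl⟩ := exists_addMonoidHom_of_factorsThrough hspan
    (w := fun u => Additive.ofMul (Units.mk0 (v u) (hv0 u))) fun α β hαβ => by
      apply Additive.toMul.injective
      ext
      simpa [Finsupp.weight_apply, Finsupp.sum, Finsupp.prod] using hv hαβ
  refine ⟨AddMonoidHom.toMultiplicativeLeft l, ?_⟩
  ext u
  simp [hl]

variable (k) in
/-- The exponential `m ↦ exp (m ε) = 1 + m ε` with values in the dual numbers. -/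
def dualExp : Multiplicative k →* DualNumber k where
  toFun m := 1 + TrivSqZeroExt.inr m.toAdd
  map_one' := by simp
  map_mul' m m' := by ext <;> simp [add_comm]

theorem aeval_dualPoint_one_monomial (w : ι → k) (α : ι →₀ ℕ) :
    aeval (dualPoint 1 w) (monomial α (1 : k)) =
      dualExp k (Multiplicative.ofAdd (Finsupp.weight w α)) := by
  have h u : dualPoint 1 w u = dualExp k (Multiplicative.ofAdd (w u)) := rfl
  simp [aeval_monomial, h, Finsupp.weight_apply, Finsupp.prod, Finsupp.sum, ofAdd_sum,
    ofAdd_nsmul, -nsmul_eq_mul]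

-- A linear function `l` on the weights is a vector field on the torus, whose value at `v` is
-- obtained by moving `v` with the `k[ε]`-point `m ↦ exp (l m ε)` of the torus.
theorem lift_dualExp_orbitPullback (a : ι → Λ) (v : ι → k) (l : Λ →ₗ[ℤ] k)
    (f : MvPolynomial ι k) :
    AddMonoidAlgebra.lift k (DualNumber k) Λ
        ((dualExp k).comp (AddMonoidHom.toMultiplicative l.toAddMonoidHom)) (orbitPullback a v f) =
      aeval (dualPoint v (v * weightMap k a l)) f := by
  rw [orbitPullback, comp_aeval_apply]
  congr 2
  ext u
  · simp [dualPoint, dualExp]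
  · simp [dualPoint, dualExp]

variable [Fintype ι]

section

variable {a : ι → Λ} (ha : IsAtHeightOne a) (t : Torus k Λ)

include ha

theorem embeddedTangentSpace_weightedAction (p : ℙ k (ι → k)) :
    embeddedTangentSpace (binomialLocus k a) (weightedAction a t p) =
      (embeddedTangentSpace (binomialLocus k a) p).map (weightedScale a t).toLinearMap := by
  conv_lhs => rw [← weightedAction_image_binomialLocus ha t]
  exact embeddedTangentSpace_map_image (weightedScale a t).injective _ p

theorem weightedAction_mem_smoothLocus_iff (p : ℙ k (ι → k)) :
    weightedAction a t p ∈ smoothLocus (binomialLocus k a) ↔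
      p ∈ smoothLocus (binomialLocus k a) := by
  conv_lhs => rw [← weightedAction_image_binomialLocus ha t]
  exact map_mem_smoothLocus_iff (weightedScale a t).injective _ p

theorem gaussFiber_weightedAction (p : ℙ k (ι → k)) :
    gaussFiber (binomialLocus k a) (weightedAction a t p) =
      weightedAction a t '' gaussFiber (binomialLocus k a) p := by
  conv_lhs => rw [← weightedAction_image_binomialLocus ha t]
  exact gaussFiber_map_image (weightedScale a t).injective _ p

end

variable [CharZero k] [Module.Free ℤ Λ] {a : ι → Λ} (ha : IsAtHeightOne a)

include ha

theorem mul_mem_embeddedTangentSpace {v : ι → k} {hv : v ≠ 0}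
    (hvX : Projectivization.mk k v hv ∈ binomialLocus k a) {w : ι → k}
    (hw : w ∈ LinearMap.range (weightMap k a)) :
    v * w ∈ embeddedTangentSpace (binomialLocus k a) (Projectivization.mk k v hv) := by
  obtain ⟨l, rfl⟩ := hw
  refine mem_embeddedTangentSpace_mk.2 fun f d hf hfX => ?_
  rw [← lift_dualExp_orbitPullback, orbitPullback_eq_zero (hc := hv) hf, map_zero,
    TrivSqZeroExt.snd_zero]
  rintro _ ⟨t, rfl⟩
  exact hfX _ (weightedAction_mem_binomialLocus ha t hvX)

variable [Nonempty ι] (hspan : Submodule.span ℤ (Set.range a) = ⊤)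

include hspan

theorem embeddedTangentSpace_unitPoint :
    embeddedTangentSpace (binomialLocus k a) (unitPoint k ι) =
      LinearMap.range (weightMap k a) := by
  refine le_antisymm (fun w hw => ?_) fun w hw => ?_
  · obtain ⟨l, hl⟩ := exists_addMonoidHom_of_factorsThrough hspan (w := w) fun α β hαβ => by
      have := mem_embeddedTangentSpace_mk.1 hw _ _
        (isHomogeneous_monomial_sub_monomial (ha.degree_eq hαβ)) fun p hp => by
          rw [eval_monomial_sub_monomial, sub_eq_zero]
          exact hp hαβ
      simpa [aeval_dualPoint_one_monomial, dualExp, sub_eq_zero] using this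
    exact ⟨l.toIntLinearMap, funext hl⟩
  · rw [← one_mul w]
    exact mul_mem_embeddedTangentSpace ha
      (orbit_unitPoint_subset_binomialLocus ha (mem_orbit_self a _)) hw

theorem unitPoint_mem_smoothLocus [Module.Finite ℤ Λ] :
    unitPoint k ι ∈ smoothLocus (binomialLocus k a) := by
  have hsub := orbit_unitPoint_subset_binomialLocus (k := k) ha
  obtain ⟨h, hh⟩ := id ha
  have hd := (finrank_ker_add_one (h := h) fun n =>
    ⟨n • a (Classical.arbitrary ι), by simp [hh]⟩).symm
  refine ⟨hsub (mem_orbit_self a _), ?_⟩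
  rw [embeddedTangentSpace_unitPoint ha hspan, finrank_range_weightMap hspan,
    topologicalKrullDim_eq_of_orbit_subset ha hspan hd hsub subset_rfl, hd]
  push_cast
  rfl

end Tangent

section MultiplierAlgebra

variable {k : Type*} [Field k] {ι : Type*}

/-- The functions that preserve a subspace of `k^ι` under pointwise multiplication. For the tangent
space at the unit point of a toric variety it describes the fiber of the Gauss map. -/
def multiplierAlgebra (V : Submodule k (ι → k)) : Subalgebra k (ι → k) where
  carrier := {g | ∀ w ∈ V, g * w ∈ V}
  mul_mem' hf hg w hw := by rw [mul_assoc]; exact hf _ (hg w hw)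
  add_mem' hf hg w hw := by rw [add_mul]; exact V.add_mem (hf w hw) (hg w hw)
  algebraMap_mem' c w hw := by rw [← Algebra.smul_def]; exact V.smul_mem c hw

variable (S : Subalgebra k (ι → k))

/-- Two points are equivalent if no function of the subalgebra separates them. -/
def nonseparatedSetoid : Setoid ι where
  r u u' := ∀ g ∈ S, g u = g u'
  iseqv := ⟨fun _ _ _ => rfl, fun h g hg => (h g hg).symm,
    fun h h' g hg => (h g hg).trans (h' g hg)⟩

variable {S}

theorem exists_mem_apply_eq_one_apply_eq_zero {u u' : ι} (h : ¬ nonseparatedSetoid S u u') :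
    ∃ g ∈ S, g u = 1 ∧ g u' = 0 := by
  obtain ⟨g, hg, hne⟩ : ∃ g ∈ S, g u ≠ g u' := by
    by_contra! hcon
    exact h hcon
  refine ⟨(g u - g u')⁻¹ • (g - algebraMap k (ι → k) (g u')),
    S.smul_mem (S.sub_mem hg (S.algebraMap_mem _)) _, ?_, ?_⟩
  · simp [inv_mul_cancel₀ (sub_ne_zero.2 hne)]
  · simp

variable [Finite ι]

theorem indicator_nonseparated_mem (u : ι) :
    Set.indicator {u' | nonseparatedSetoid S u u'} 1 ∈ S := by
  classical
  cases nonempty_fintype ι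
  have hsep (u') : ∃ g ∈ S, g u = 1 ∧ (¬ nonseparatedSetoid S u u' → g u' = 0) := by
    by_cases hu : nonseparatedSetoid S u u'
    · exact ⟨1, S.one_mem, rfl, fun h => absurd hu h⟩
    · obtain ⟨g, hg, hgu, hgu'⟩ := exists_mem_apply_eq_one_apply_eq_zero hu
      exact ⟨g, hg, hgu, fun _ => hgu'⟩
  choose g hgS hgu hgu' using hsep
  convert S.prod_mem fun u' (_ : u' ∈ Finset.univ) => hgS u'
  ext u'
  rw [Finset.prod_apply]
  by_cases hu : nonseparatedSetoid S u u'
  · rw [Set.indicator_of_mem hu]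
    exact (Finset.prod_eq_one fun w _ => (hu _ (hgS w)).symm.trans (hgu w)).symm
  · rw [Set.indicator_of_notMem hu]
    exact (Finset.prod_eq_zero (f := fun c => g c u') (Finset.mem_univ u') (hgu' u' hu)).symm

theorem mem_iff_factorsThrough_quotientMk {g : ι → k} :
    g ∈ S ↔ Function.FactorsThrough g (Quotient.mk (nonseparatedSetoid S)) := by
  classical
  cases nonempty_fintype (Quotient (nonseparatedSetoid S))
  refine ⟨fun hg u u' h => Quotient.exact h g hg, fun hg => ?_⟩
  have hsum : g = ∑ q : Quotient (nonseparatedSetoid S),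
      g q.out • Set.indicator {u' | nonseparatedSetoid S q.out u'} 1 := by
    ext u
    have hout (q : Quotient (nonseparatedSetoid S)) :
        nonseparatedSetoid S q.out u ↔ q = Quotient.mk _ u := by
      rw [← Quotient.eq, Quotient.out_eq]
    simp [Set.indicator_apply, hout, hg (Quotient.out_eq (Quotient.mk _ u))]
  rw [hsum]
  exact S.sum_mem fun q _ => S.smul_mem (indicator_nonseparated_mem _) _

theorem exists_surjective_mem_iff_factorsThrough (S : Subalgebra k (ι → k)) :
    ∃ (n : ℕ) (B : ι → Fin n), Function.Surjective B ∧
      ∀ g, g ∈ S ↔ Function.FactorsThrough g B := by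
  let e := Finite.equivFin (Quotient (nonseparatedSetoid S))
  refine ⟨_, e ∘ Quotient.mk _, e.surjective.comp Quotient.mk_surjective, fun g => ?_⟩
  simp only [mem_iff_factorsThrough_quotientMk, Function.FactorsThrough, Function.comp_apply,
    e.injective.eq_iff]

end MultiplierAlgebra

section Blocks

variable {k : Type*} [Field k] {Λ : Type*} [AddCommGroup Λ] {ι J : Type*}

/-- The weights of the torus of the simplex whose vertices are the blocks of the partition `B`. -/
def blockWeight (B : ι → J) (u : ι) : J →₀ ℤ := Finsupp.single (B u) 1

theorem isAtHeightOne_blockWeight (B : ι → J) : IsAtHeightOne (blockWeight B) :=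
  ⟨Finsupp.linearCombination ℤ fun _ => 1, fun u => by simp [blockWeight]⟩

theorem span_range_blockWeight {B : ι → J} (hB : Function.Surjective B) :
    Submodule.span ℤ (Set.range (blockWeight B)) = ⊤ := by
  rw [← Finsupp.basisSingleOne.span_eq, ← hB.range_comp]
  congr 2

theorem weight_blockWeight (B : ι → J) (α : ι →₀ ℕ) :
    Finsupp.weight (blockWeight B) α = (α.mapDomain B).mapRange (Nat.cast : ℕ → ℤ) rfl := by
  induction α using Finsupp.induction_linear with
  | zero => simp
  | add α β hα hβ =>
    rw [map_add, hα, hβ, Finsupp.mapDomain_add, Finsupp.mapRange_add Nat.cast_add]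
  | single u n => simp [Finsupp.weight_apply, blockWeight]

theorem mapDomain_eq_of_weight_blockWeight_eq {B : ι → J} {α β : ι →₀ ℕ}
    (h : Finsupp.weight (blockWeight B) α = Finsupp.weight (blockWeight B) β) :
    α.mapDomain B = β.mapDomain B := by
  rw [weight_blockWeight, weight_blockWeight] at h
  exact Finsupp.mapRange_injective _ rfl Nat.cast_injective h

theorem satisfiesBinomials_of_factorsThrough {a : ι → Λ} {B : ι → J}
    (ha : Function.FactorsThrough (Finsupp.mapDomain (M := ℕ) B) (Finsupp.weight a)) {v : ι → k}
    (hv : Function.FactorsThrough v B) : SatisfiesBinomials a v := by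
  obtain ⟨c, rfl⟩ := (Function.factorsThrough_iff v).1 hv
  intro α β hαβ
  have h (α : ι →₀ ℕ) : (α.prod fun u n => (c ∘ B) u ^ n) =
      (α.mapDomain B).prod fun j n => c j ^ n := by
    rw [Finsupp.prod_mapDomain_index] <;> simp [pow_add]
  simp only [h, ha hαβ]

variable [DecidableEq J]

/-- Every relation between the weights `a` is a sum of relations inside the blocks of the partition
`B`; geometrically, the toric variety is a join along the blocks. -/
def SplitsAlong (a : ι → Λ) (B : ι → J) : Prop :=
  ∀ j, Function.FactorsThrough
    (fun α : ι →₀ ℕ => Finsupp.weight a (α.filter fun u => B u = j)) (Finsupp.weight a)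

theorem mapDomain_apply_eq_degree_filter (B : ι → J) (α : ι →₀ ℕ) (j : J) :
    α.mapDomain B j = (α.filter fun u => B u = j).degree := by
  induction α using Finsupp.induction_linear with
  | zero => simp [Finsupp.filter_zero]
  | add α β hα hβ => simp [Finsupp.mapDomain_add, Finsupp.filter_add, hα, hβ]
  | single u n =>
    by_cases h : B u = j
    · simp [h]
    · simp [h, Finsupp.filter_single_of_neg]

theorem SplitsAlong.factorsThrough_mapDomain {a : ι → Λ} {B : ι → J} (hB : SplitsAlong a B)
    (ha : IsAtHeightOne a) :
    Function.FactorsThrough (Finsupp.mapDomain (M := ℕ) B) (Finsupp.weight a) := by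
  intro α β hαβ
  ext j
  rw [mapDomain_apply_eq_degree_filter, mapDomain_apply_eq_degree_filter]
  exact ha.degree_eq (hB j hαβ)

theorem SplitsAlong.satisfiesBinomials_sum [Fintype J] {a : ι → Λ} {B : ι → J}
    (hB : SplitsAlong a B) {v : J → ι → k} (hv : ∀ j, SatisfiesBinomials a (v j))
    (hv0 : ∀ j u, B u ≠ j → v j u = 0) : SatisfiesBinomials a (∑ j, v j) := by
  have hsum (u) : (∑ j, v j) u = v (B u) u := by
    rw [Finset.sum_apply]
    exact Finset.sum_eq_single _ (fun j _ hj => hv0 j u hj.symm) (by simp)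
  have hprod (α : ι →₀ ℕ) : (α.prod fun u n => (∑ j, v j) u ^ n) =
      ∏ j, (α.filter fun u => B u = j).prod fun u n => v j u ^ n := by
    rw [Finsupp.prod, ← Finset.prod_fiberwise _ B]
    refine Finset.prod_congr rfl fun j _ => ?_
    rw [Finsupp.prod_filter_index, Finsupp.support_filter]
    refine Finset.prod_congr rfl fun u hu => ?_
    rw [hsum, (Finset.mem_filter.1 hu).2]
  intro α β hαβ
  simp only [hprod]
  exact Finset.prod_congr rfl fun j _ => hv j (hB j hαβ)

theorem eq_of_forall_linearMap_eq [CharZero k] [Module.Free ℤ Λ] {m m' : Λ}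
    (h : ∀ l : Λ →ₗ[ℤ] k, l m = l m') : m = m' := by
  let b := Module.Free.chooseBasis ℤ Λ
  refine b.ext_elem fun i => ?_
  simpa using h (Algebra.linearMap ℤ k ∘ₗ b.coord i)

theorem SplitsAlong.of_mem_multiplierAlgebra [CharZero k] [Module.Free ℤ Λ] {a : ι → Λ} {B : ι → J}
    (hB : ∀ j, (Pi.single j 1 : J → k) ∘ B ∈
      multiplierAlgebra (LinearMap.range (weightMap k a))) : SplitsAlong a B := by
  intro j α β hαβ
  refine eq_of_forall_linearMap_eq (k := k) fun l => ?_
  obtain ⟨l', hl'⟩ := hB j _ ⟨l, rfl⟩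
  have weight_filter_eq (γ : ι →₀ ℕ) :
      l (Finsupp.weight a (γ.filter fun u => B u = j)) = l' (Finsupp.weight a γ) := by
    induction γ using Finsupp.induction_linear with
    | zero => simp [Finsupp.filter_zero]
    | add γ δ hγ hδ => simp [Finsupp.filter_add, hγ, hδ]
    | single u n =>
      have hu : l' (a u) = (Pi.single j 1 : J → k) (B u) * l (a u) := congrFun hl' u
      by_cases h : B u = j
      · simp [h, hu, Finsupp.weight_apply]
      · simp [h, hu, Finsupp.weight_apply, Finsupp.filter_single_of_neg]
  simp only [weight_filter_eq, hαβ]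

end Blocks

section GaussDefect

variable {k : Type*} [Field k] {Λ : Type*} [AddCommGroup Λ] {ι J : Type*}

theorem rep_mk_apply_eq_zero_iff {v : ι → k} (hv : v ≠ 0) (u : ι) :
    (Projectivization.mk k v hv).rep u = 0 ↔ v u = 0 := by
  simpa only [eval_X] using eval_rep_mk_eq_zero_iff (isHomogeneous_X k u) v hv

theorem mem_orbit_unitPoint [Nonempty ι] {a : ι → Λ}
    (hspan : Submodule.span ℤ (Set.range a) = ⊤) {p : ℙ k (ι → k)} (hp : p ∈ binomialLocus k a)
    (hp0 : ∀ u, p.rep u ≠ 0) : p ∈ orbit a (unitPoint k ι) := by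
  obtain ⟨t, ht⟩ := exists_weightedScale_one_eq hspan hp hp0
  refine ⟨t, ?_⟩
  simp only [unitPoint, weightedAction_mk, ht, Projectivization.mk_rep]

variable [CharZero k] [Module.Free ℤ Λ] [Fintype ι] [Nonempty ι] {a : ι → Λ} {B : ι → J}
  (ha : IsAtHeightOne a) (hspan : Submodule.span ℤ (Set.range a) = ⊤)
  (hB : ∀ g, g ∈ multiplierAlgebra (LinearMap.range (weightMap k a)) ↔ Function.FactorsThrough g B)

include ha hspan hB

theorem gaussFiber_unitPoint_subset :
    gaussFiber (binomialLocus k a) (unitPoint k ι) ⊆ binomialLocus k (blockWeight B) := by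
  rintro y ⟨hy, hT⟩
  induction y using Projectivization.ind with
  | h v hv =>
    rw [embeddedTangentSpace_unitPoint ha hspan] at hT
    refine (mk_mem_binomialLocus_iff (isAtHeightOne_blockWeight B)).2
      (satisfiesBinomials_of_factorsThrough (fun _ _ => mapDomain_eq_of_weight_blockWeight_eq)
        ((hB v).1 fun w hw => ?_))
    rw [← hT]
    exact mul_mem_embeddedTangentSpace ha hy.1 hw

variable [Module.Finite ℤ Λ]

theorem orbit_blockWeight_subset_gaussFiber :
    orbit (blockWeight B) (unitPoint k ι) ⊆ gaussFiber (binomialLocus k a) (unitPoint k ι) := by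
  classical
  rintro _ ⟨s, rfl⟩
  have hs : Function.FactorsThrough (weightedScale (blockWeight B) s 1) B := fun u u' h => by
    simp [blockWeight, h]
  have hsplit : SplitsAlong a B :=
    .of_mem_multiplierAlgebra (k := k) fun j => (hB _).2 fun _ _ h => congrArg (Pi.single j 1) h
  obtain ⟨t, ht⟩ := exists_weightedScale_one_eq hspan
    (satisfiesBinomials_of_factorsThrough (hsplit.factorsThrough_mapDomain ha) hs) fun u => by simp
  have hst : weightedAction (blockWeight B) s (unitPoint k ι) =
      weightedAction a t (unitPoint k ι) := by
    simp only [unitPoint, weightedAction_mk, ht]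
  change weightedAction (blockWeight B) s _ ∈ _
  rw [hst]
  refine ⟨(weightedAction_mem_smoothLocus_iff ha t _).2 (unitPoint_mem_smoothLocus ha hspan), ?_⟩
  rw [embeddedTangentSpace_weightedAction ha, embeddedTangentSpace_unitPoint ha hspan]
  refine Submodule.eq_of_le_of_finrank_eq ?_ (LinearEquiv.finrank_map_eq _ _)
  rintro _ ⟨w, hw, rfl⟩
  convert (hB _).2 hs w hw using 1
  rw [← ht]
  ext u
  simp

theorem isGaussDefect_binomialLocus [Fintype J] (hBs : Function.Surjective B) {δ : ℕ}
    (hδ : Fintype.card J = δ + 1) : IsGaussDefect (binomialLocus k a) δ := by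
  refine ⟨⋂ u, {p | p.rep u = 0}ᶜ, ?_, ⟨unitPoint k ι, ?_, ?_⟩, ?_⟩
  · refine isOpen_iInter_of_finite fun u => IsClosed.isOpen_compl (self := ?_)
    simpa only [eval_X] using isClosed_setOf_eval_rep_eq_zero (isHomogeneous_X k u)
  · exact orbit_unitPoint_subset_binomialLocus ha (mem_orbit_self a _)
  · exact Set.mem_iInter.2 fun u => (rep_mk_apply_eq_zero_iff one_ne_zero u).not.2 one_ne_zero
  · rintro x ⟨hx, hxU⟩
    obtain ⟨t, rfl⟩ := mem_orbit_unitPoint hspan hx (Set.mem_iInter.1 hxU)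
    refine ⟨(weightedAction_mem_smoothLocus_iff ha t _).2 (unitPoint_mem_smoothLocus ha hspan), ?_⟩
    change topologicalKrullDim (gaussFiber _ (weightedAction a t _)) = _
    rw [gaussFiber_weightedAction ha]
    exact (topologicalKrullDim_map_image (weightedScale a t).injective _).trans
      (topologicalKrullDim_eq_of_orbit_subset (isAtHeightOne_blockWeight B)
        (span_range_blockWeight hBs) (by rw [Module.finrank_finsupp_self, hδ])
        (orbit_blockWeight_subset_gaussFiber ha hspan hB) (gaussFiber_unitPoint_subset ha hspan hB))

end GaussDefect

section Join

variable {k : Type*} [Field k] {Λ : Type*} [AddCommGroup Λ] {ι J : Type*} [DecidableEq J]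
  {a : ι → Λ} {B : ι → J}

theorem single_comp_ne_zero (hBs : Function.Surjective B) (j : J) :
    (Pi.single j 1 : J → k) ∘ B ≠ 0 := by
  obtain ⟨u, rfl⟩ := hBs j
  exact fun h => by simpa using congrFun h u

/-- The closed torus orbit of the indicator function of the block `j`. -/
def blockVariety (k : Type*) [Field k] (a : ι → Λ) (hBs : Function.Surjective B) (j : J) :
    Set (ℙ k (ι → k)) :=
  closure (orbit a (Projectivization.mk k _ (single_comp_ne_zero hBs j)))

variable {hBs : Function.Surjective B}

theorem rep_eq_zero_of_mem_blockVariety {j : J} {p : ℙ k (ι → k)} (hp : p ∈ blockVariety k a hBs j)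
    {u : ι} (hu : B u ≠ j) : p.rep u = 0 := by
  simpa only [eval_X] using mem_closure_iff_eval.1 hp (X u) 1 (isHomogeneous_X k u) <| by
    rintro _ ⟨t, rfl⟩
    rw [eval_X]
    exact (rep_mk_apply_eq_zero_iff _ u).2 (by simp [hu])

theorem disjoint_blockVariety {i j : J} (hij : i ≠ j) :
    Disjoint (blockVariety k a hBs i) (blockVariety k a hBs j) := by
  refine Set.disjoint_left.2 fun p hi hj => p.rep_nonzero (funext fun u => ?_)
  by_cases hu : B u = i
  · exact rep_eq_zero_of_mem_blockVariety hj (hu ▸ hij)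
  · exact rep_eq_zero_of_mem_blockVariety hi hu

theorem blockVariety_subset (ha : IsAtHeightOne a) (hB : SplitsAlong a B) (j : J) :
    blockVariety k a hBs j ⊆ binomialLocus k a := by
  refine closure_minimal ?_ (isClosed_binomialLocus ha)
  rintro _ ⟨t, rfl⟩
  exact weightedAction_mem_binomialLocus ha t ((mk_mem_binomialLocus_iff ha).2
    (satisfiesBinomials_of_factorsThrough (hB.factorsThrough_mapDomain ha)
      fun _ _ h => congrArg (Pi.single j 1) h))

variable [Finite J]

theorem join_blockVariety_subset (ha : IsAtHeightOne a) (hB : SplitsAlong a B) :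
    join (blockVariety k a hBs) ⊆ binomialLocus k a := by
  cases nonempty_fintype J
  refine closure_minimal ?_ (isClosed_binomialLocus ha)
  rintro p ⟨x, hx, hp⟩
  induction p using Projectivization.ind with
  | h v hv =>
    have hspan : v ∈ Submodule.span k (Set.range fun j => (x j).rep) :=
      (mk_mem_span_range_mk_iff (fun j => (x j).rep_nonzero) hv).1
        (by simpa only [Projectivization.mk_rep] using hp)
    obtain ⟨c, rfl⟩ := (Submodule.mem_span_range_iff_exists_fun k).1 hspan
    refine (mk_mem_binomialLocus_iff ha).2
      (hB.satisfiesBinomials_sum (fun j => ?_) fun j u hu => ?_)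
    · exact SatisfiesBinomials.smul ha (blockVariety_subset ha hB j (hx j)) (c j)
    · rw [Pi.smul_apply, rep_eq_zero_of_mem_blockVariety (hx j) hu, smul_zero]

theorem orbit_unitPoint_subset_join_blockVariety [Nonempty ι] :
    orbit a (unitPoint k ι) ⊆ join (blockVariety k a hBs) := by
  cases nonempty_fintype J
  rintro _ ⟨t, rfl⟩
  refine subset_closure ⟨fun j => weightedAction a t
    (Projectivization.mk k _ (single_comp_ne_zero hBs j)), fun j => subset_closure ⟨t, rfl⟩, ?_⟩
  simp only [unitPoint, weightedAction_mk]
  rw [mk_mem_span_range_mk_iff]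
  have hsum : weightedScale a t 1 = ∑ j, weightedScale a t ((Pi.single j 1 : J → k) ∘ B) := by
    rw [← map_sum]
    congr 1
    ext u
    simp [Pi.single_apply]
  rw [hsum]
  exact Submodule.sum_mem _ fun j _ => Submodule.subset_span ⟨j, rfl⟩

theorem join_blockVariety [CharZero k] [Module.Free ℤ Λ] [Nonempty ι] (ha : IsAtHeightOne a)
    (hB : SplitsAlong a B) : join (blockVariety k a hBs) = binomialLocus k a := by
  refine (join_blockVariety_subset ha hB).antisymm ?_
  rw [← closure_orbit_unitPoint ha]
  exact closure_minimal orbit_unitPoint_subset_join_blockVariety isClosed_closure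

end Join

theorem exists_isGaussDefect_join_eq_binomialLocus {k : Type*} [Field k] [CharZero k] {Λ : Type*}
    [AddCommGroup Λ] [Module.Free ℤ Λ] [Module.Finite ℤ Λ] {ι : Type*} [Fintype ι] [Nonempty ι]
    {a : ι → Λ} (ha : IsAtHeightOne a) (hspan : Submodule.span ℤ (Set.range a) = ⊤) :
    ∃ δ : ℕ, IsGaussDefect (binomialLocus k a) δ ∧
      ∃ Y : Fin (δ + 1) → Set (ℙ k (ι → k)),
        (∀ i, IsProjectiveVariety (Y i) ∧ Y i ⊆ binomialLocus k a ∧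
          ∀ t : Torus k Λ, ∀ y ∈ Y i, weightedAction a t y ∈ Y i) ∧
        (∀ i i', i ≠ i' → Disjoint (Y i) (Y i')) ∧ join Y = binomialLocus k a := by
  obtain ⟨n, B, hBs, hB⟩ := exists_surjective_mem_iff_factorsThrough
    (multiplierAlgebra (LinearMap.range (weightMap k a)))
  obtain ⟨δ, rfl⟩ := Nat.exists_eq_succ_of_ne_zero (B (Classical.arbitrary ι)).pos.ne'
  have hsplit : SplitsAlong a B :=
    .of_mem_multiplierAlgebra (k := k) fun j => (hB _).2 fun _ _ h => congrArg (Pi.single j 1) h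
  exact ⟨δ, isGaussDefect_binomialLocus ha hspan hB hBs (Fintype.card_fin _), blockVariety k a hBs,
    fun i => ⟨⟨isClosed_closure, (isIrreducible_orbit _ _).closure⟩,
      blockVariety_subset ha hsplit i, fun t _ hy => weightedAction_mem_closure_orbit t hy⟩,
    fun _ _ => disjoint_blockVariety, join_blockVariety ha hsplit⟩

section ToricVariety

variable {k : Type*} [Field k] {M : Type*} [AddCommGroup M]

/-- The point `u` of `A`, placed at height one. -/
def liftPoint (A : Finset M) (u : A) : M × ℤ := (u, 1)

/-- The lattice generated by the points of `A` at height one. -/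
abbrev coneLattice (A : Finset M) : Submodule ℤ (M × ℤ) :=
  Submodule.span ℤ (Set.range (liftPoint A))

/-- The points of `A` at height one, as elements of the lattice that they generate. -/
def generator (A : Finset M) (u : A) : coneLattice A :=
  ⟨liftPoint A u, Submodule.subset_span ⟨u, rfl⟩⟩

instance (A : Finset M) : Module.Finite ℤ (coneLattice A) :=
  .span_of_finite ℤ (Set.finite_range _)

theorem isAtHeightOne_liftPoint (A : Finset M) : IsAtHeightOne (liftPoint A) :=
  ⟨LinearMap.snd ℤ M ℤ, fun _ => rfl⟩

theorem isAtHeightOne_generator (A : Finset M) : IsAtHeightOne (generator A) :=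
  ⟨LinearMap.snd ℤ M ℤ ∘ₗ (coneLattice A).subtype, fun _ => rfl⟩

theorem span_range_generator (A : Finset M) :
    Submodule.span ℤ (Set.range (generator A)) = ⊤ := by
  apply Submodule.map_injective_of_injective (coneLattice A).subtype_injective
  rw [Submodule.map_span, ← Set.range_comp, Submodule.map_top, Submodule.range_subtype]
  rfl

theorem range_toricMap (A : Finset M) (hA : A.Nonempty) [Nonempty A] :
    Set.range (toricMap (k := k) A hA) = orbit (liftPoint A) (unitPoint k A) := by
  refine Set.Subset.antisymm ?_ ?_
  · rintro _ ⟨t, rfl⟩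
    refine ⟨t.comp (AddMonoidHom.toMultiplicative (AddMonoidHom.fst M ℤ)), ?_⟩
    simp only [unitPoint, weightedAction_mk, toricMap]
    congr 1
    ext u
    simp [liftPoint]
  · rintro _ ⟨s, rfl⟩
    refine ⟨s.comp (AddMonoidHom.toMultiplicative (AddMonoidHom.inl M ℤ)), ?_⟩
    simp only [unitPoint, weightedAction_mk, toricMap]
    rw [Projectivization.mk_eq_mk_iff]
    refine ⟨(s (Multiplicative.ofAdd (0, 1)))⁻¹, ?_⟩
    ext u
    have hu : Multiplicative.ofAdd (liftPoint A u) =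
        Multiplicative.ofAdd ((0 : M), (1 : ℤ)) * Multiplicative.ofAdd ((u : M), (0 : ℤ)) := by
      simp [← ofAdd_add, liftPoint]
    simp [hu, Units.smul_def]

theorem binomialLocus_comp {Λ Γ ι : Type*} [AddCommGroup Λ] [AddCommGroup Γ] {l : Λ →+ Γ}
    (hl : Function.Injective l) (a : ι → Λ) : binomialLocus k (l ∘ a) = binomialLocus k a := by
  ext p
  simp only [binomialLocus, SatisfiesBinomials, Function.FactorsThrough, weight_comp, hl.eq_iff]

theorem toricVariety_eq_binomialLocus [CharZero k] [Module.Free ℤ M] (A : Finset M)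
    (hA : A.Nonempty) : toricVariety k A hA = binomialLocus k (generator A) := by
  have := hA.to_subtype
  rw [toricVariety, range_toricMap, closure_orbit_unitPoint (isAtHeightOne_liftPoint A)]
  exact binomialLocus_comp (l := (coneLattice A).subtype.toAddMonoidHom)
    (coneLattice A).subtype_injective (generator A)

theorem torusAction_eq_weightedAction (A : Finset M) (t : Torus k M) :
    torusAction A t = weightedAction (generator A) (t.comp (AddMonoidHom.toMultiplicative
      (LinearMap.fst ℤ M ℤ ∘ₗ (coneLattice A).subtype).toAddMonoidHom)) := rfl

theorem isTorusInvariant_of_weightedAction {A : Finset M} {Y : Set (ℙ k (A → k))}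
    (hY : ∀ t : Torus k (coneLattice A), ∀ y ∈ Y, weightedAction (generator A) t y ∈ Y) :
    IsTorusInvariant A Y := by
  intro t y hy
  rw [torusAction_eq_weightedAction]
  exact hY _ y hy

theorem iSup_submodule_toricVariety [CharZero k] [Module.Free ℤ M] (A : Finset M)
    (hA : A.Nonempty) : ⨆ p ∈ toricVariety k A hA, p.submodule = ⊤ := by
  have hspan : Submodule.span k (Set.range fun (t : Torus k M) (u : A) =>
      (t (Multiplicative.ofAdd (u : M)) : k)) = ⊤ :=
    span_flip_eq_top_iff_linearIndependent.2
      (linearIndependent_torus_apply.comp _ Subtype.val_injective)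
  rw [eq_top_iff, ← hspan, Submodule.span_range_eq_iSup]
  exact iSup_le fun t => le_iSup₂_of_le (toricMap A hA t) (subset_closure ⟨t, rfl⟩)
    (Projectivization.submodule_mk _ _).ge

end ToricVariety

theorem exists_comp_eq_of_map_image_eq {K E F V : Type*} [Field K] [AddCommGroup E] [Module K E]
    [AddCommGroup F] [Module K F] [AddCommGroup V] [Module K V] {X : Set (ℙ K E)} {Z : Set (ℙ K F)}
    {j₁ : E →ₗ[K] V} (hj₁ : Function.Injective j₁) {j₂ : F →ₗ[K] V} (hj₂ : Function.Injective j₂)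
    (hXZ : Projectivization.map j₁ hj₁ '' X = Projectivization.map j₂ hj₂ '' Z)
    (hZ : ⨆ z ∈ Z, z.submodule = ⊤) : ∃ j : F →ₗ[K] E, j₁ ∘ₗ j = j₂ := by
  have hrange : LinearMap.range j₂ ≤ LinearMap.range j₁ := by
    rw [LinearMap.range_eq_map, ← hZ]
    simp only [Submodule.map_iSup]
    refine iSup₂_le fun z hz => ?_
    obtain ⟨x, -, hx⟩ := hXZ.superset ⟨z, hz, rfl⟩
    rw [← submodule_map j₂ hj₂, ← hx, submodule_map]
    exact LinearMap.map_le_range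
  obtain ⟨r, hr⟩ := j₁.exists_leftInverse_of_injective (LinearMap.ker_eq_bot.2 hj₁)
  refine ⟨r ∘ₗ j₂, LinearMap.ext fun v => ?_⟩
  obtain ⟨w, hw⟩ := hrange ⟨v, rfl⟩
  simp only [LinearMap.comp_apply, ← hw]
  rw [← LinearMap.comp_apply r, hr, LinearMap.id_apply]

end ToricGauss

end

theorem corollary1p3_general {k : Type*} [Field k] [CharZero k] {M : Type*} [AddCommGroup M]
    [Module.Free ℤ M] (A : Finset M) (hA : A.Nonempty) {ι : Type*} [Fintype ι]
    (X : Set (ℙ k (ι → k))) {V : Type*} [AddCommGroup V] [Module k V]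
    (j₁ : (ι → k) →ₗ[k] V) (hj₁ : Function.Injective j₁)
    (j₂ : (A → k) →ₗ[k] V) (hj₂ : Function.Injective j₂)
    (hX : Projectivization.map j₁ hj₁ '' X =
      Projectivization.map j₂ hj₂ '' ToricGauss.toricVariety k A hA) :
    ∃ δ : ℕ, ToricGauss.IsGaussDefect X δ ∧
      ∃ Y : Fin (δ + 1) → Set (ℙ k (ι → k)),
        (∀ i, ToricGauss.IsProjectiveVariety (Y i) ∧ Y i ⊆ X ∧
          ToricGauss.IsTorusInvariant A
            (Projectivization.map j₂ hj₂ ⁻¹' (Projectivization.map j₁ hj₁ '' Y i))) ∧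
        (∀ i i', i ≠ i' → Disjoint (Y i) (Y i')) ∧
        ToricGauss.join Y = X := by
  have : Nonempty A := hA.to_subtype
  obtain ⟨j, rfl⟩ := ToricGauss.exists_comp_eq_of_map_image_eq hj₁ hj₂ hX
    (ToricGauss.iSup_submodule_toricVariety A hA)
  have hj : Function.Injective j := Function.Injective.of_comp (f := j₁) hj₂
  have himage (Z) : Projectivization.map (j₁ ∘ₗ j) hj₂ '' Z =
      Projectivization.map j₁ hj₁ '' (Projectivization.map j hj '' Z) := by
    rw [Projectivization.map_comp j hj j₁ hj₁, Set.image_comp]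
  obtain rfl : X = Projectivization.map j hj '' ToricGauss.toricVariety k A hA :=
    (Projectivization.map_injective j₁ hj₁).image_injective (hX.trans (himage _))
  rw [ToricGauss.toricVariety_eq_binomialLocus]
  obtain ⟨δ, hδ, Y, hY, hdisj, hjoin⟩ := ToricGauss.exists_isGaussDefect_join_eq_binomialLocus
    (k := k) (ToricGauss.isAtHeightOne_generator A) (ToricGauss.span_range_generator A)
  refine ⟨δ, hδ.map hj, fun i => Projectivization.map j hj '' Y i,
    fun i => ⟨(hY i).1.map hj, Set.image_mono (hY i).2.1, ?_⟩,
    fun i i' hi => (Set.disjoint_image_iff (Projectivization.map_injective j hj)).2 (hdisj i i' hi),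
    by rw [ToricGauss.join_map_image, hjoin]⟩
  rw [← himage, Set.preimage_image_eq _ (Projectivization.map_injective _ hj₂)]
  exact ToricGauss.isTorusInvariant_of_weightedAction (hY i).2.2

/-- `X ⊆ ℙ^N` is projectively equivalent to the toric variety `X_A` by means of linear embeddings
`j₁`, `j₂` of the two ambient spaces into some `ℙ^L`. For `Y ⊆ X`, the set
`j₂⁻¹ (j₁ Y)` is the copy of `Y` in `X_A`. -/
theorem corollary1p3 {k : Type*} [Field k] [IsAlgClosed k] [CharZero k]
    {M : Type*} [AddCommGroup M] [Module.Free ℤ M] [Module.Finite ℤ M]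
    (A : Finset M) (hA : A.Nonempty) (N L : ℕ)
    (X : Set (ℙ k (Fin (N + 1) → k)))
    (j₁ : (Fin (N + 1) → k) →ₗ[k] (Fin (L + 1) → k)) (hj₁ : Function.Injective j₁)
    (j₂ : (A → k) →ₗ[k] (Fin (L + 1) → k)) (hj₂ : Function.Injective j₂)
    (hX : Projectivization.map j₁ hj₁ '' X =
      Projectivization.map j₂ hj₂ '' ToricGauss.toricVariety k A hA) :
    ∃ δ : ℕ, ToricGauss.IsGaussDefect X δ ∧
      ∃ Y : Fin (δ + 1) → Set (ℙ k (Fin (N + 1) → k)),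
        (∀ i, ToricGauss.IsProjectiveVariety (Y i) ∧ Y i ⊆ X ∧
          ToricGauss.IsTorusInvariant A
            (Projectivization.map j₂ hj₂ ⁻¹' (Projectivization.map j₁ hj₁ '' Y i))) ∧
        (∀ i i', i ≠ i' → Disjoint (Y i) (Y i')) ∧
        ToricGauss.join Y = X :=
  corollary1p3_general A hA X j₁ hj₁ j₂ hj₂ hX
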